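/- Conventions. A simplicial complex $\mathsf K$ is a family of finite sets (faces, including $\emptyset$) closed under taking subsets; its facets are its inclusion-maximal faces, and a face $f$ has dimension $|f|-1$. A PL $k$-ball ($k\ge 0$) is a simplicial complex that is PL homeomorphic to (i.e. has a finite subdivision isomorphic to a subdivision of) the complex of all subsets of a $(k+1)$-element set. The link of a face $f$ of $\mathsf B$ is $\{g\in\mathsf B: g\cup f\in\mathsf B,\ g\cap f=\emptyset\}$. The boundary complex $\partial\mathsf B$ of a PL ball $\mathsf B$ consists of the faces of $\mathsf B$ whose link is a PL ball. A PL $d$-ball $\mathsf B$ is $k$-stacked if every face of $\mathsf B$ of dimension at most $d-k-1$ lies in $\partial\mathsf B$, and is $k$-neighborly with respect to $V$ if every $k$-subset of $V$ is a face of $\mathsf B$. For a simplicial complex $\mathsf L$ on a vertex set $V$, a single element extension of $\mathsf L$ in dimension $d$ which adds a new vertex $w\notin V$ is a family $$\mathsf K=(\mathsf L\setminus \mathsf B)\ \cup\ \{f,\ f\cup\{w\} : f\in\partial \mathsf B\},$$ where $\mathsf B\subseteq \mathsf L$ is a subcomplex which is a PL $d$-ball, is $(\lfloor (d+1)/2\rfloor-1)$-neighborly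 with respect to $V$, and is $(\lfloor (d+1)/2\rfloor-1)$-stacked. For $t_1<\dots<t_n$ with $n\ge d+2$, the cyclic polytope $C_{d+1}(n)$ is the convex hull of the points $(t_i,t_i^2,\dots,t_i^{d+1})\in\mathbb R^{d+1}$, $1\le i\le n$; its boundary complex consists of all subsets of the vertex sets of its facets. Proposition. Let $d\ge 2$ and $n\ge d+2$. Let $\mathsf K$ be obtained from the boundary complex of a cyclic polytope $C_{d+1}(n)$ (on its set of $n$ vertices) by one single element extension in dimension $d$ which adds a new vertex $w$. (Such a $\mathsf K$ is always a neighborly $d$-sphere.) Then the facet hypergraph of $\mathsf K$ is $2$-colorable: the vertices of $\mathsf K$ can be colored with two colors so that no facet of $\mathsf K$ is monochromatic. -/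

import Mathlib

/-! Hypergraphs with finite hyperedges are families `H : Set (Finset α)`.  A simplicial complex is
such a family that is closed under passing to subsets (`IsLowerSet`); it contains the empty face. -/

namespace NeighborlySphere

/-- `H` is `m`-colorable: there is a coloring with `m` colors none of whose color classes contains
a hyperedge. -/
def IsColorable {α : Type*} (m : ℕ) (H : Set (Finset α)) : Prop :=
  ∃ c : α → Fin m, ∀ i : Fin m, ∀ f ∈ H, ¬ ((f : Set α) ⊆ c ⁻¹' {i})

/-- The facet hypergraph of a complex: its inclusion-maximal faces. -/
def facets {α : Type*} (K : Set (Finset α)) : Set (Finset α) :=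
  {f | f ∈ K ∧ ∀ g ∈ K, f ⊆ g → g = f}

/-- The simplicial complex generated by a hypergraph: the union of the full simplices on its
hyperedges. -/
def complexOf {α : Type*} (H : Set (Finset α)) : Set (Finset α) :=
  {g | ∃ f ∈ H, g ⊆ f}

/-- The join of two hypergraphs. -/
def join {α : Type*} [DecidableEq α] (H₁ H₂ : Set (Finset α)) : Set (Finset α) :=
  {h | ∃ f₁ ∈ H₁, ∃ f₂ ∈ H₂, h = f₁ ∪ f₂}

/-- The link of `f` in `K`. -/
def link {α : Type*} [DecidableEq α] (K : Set (Finset α)) (f : Finset α) : Set (Finset α) :=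
  {g | g ∈ K ∧ g ∪ f ∈ K ∧ Disjoint g f}

/-- The copy of `K` obtained by renaming the vertices along an injection. -/
def relabel {α β : Type*} (e : α ↪ β) (K : Set (Finset α)) : Set (Finset β) :=
  (fun f => f.map e) '' K

/-- `K` is `k`-neighborly with respect to `V`: every `k`-subset of `V` is a face. -/
def IsNeighborly {α : Type*} (k : ℕ) (V : Finset α) (K : Set (Finset α)) : Prop :=
  ∀ s : Finset α, s ⊆ V → s.card = k → s ∈ K

/-! ### Piecewise linear balls -/

/-- The realization of `K`: the vertex `v` is put at the basis vector `e_v` of `ℝ^(α)`, and a face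
is realized by the convex hull of its vertices. -/
noncomputable def realization {α : Type*} (K : Set (Finset α)) : Set (α →₀ ℝ) :=
  ⋃ f ∈ K, convexHull ℝ ((fun v => Finsupp.single v (1 : ℝ)) '' (f : Set α))

/-- `S` is a (finite) subdivision of the realization of `K`: it has the same underlying space, and
each of its simplices lies in a simplex of `K`. -/
def IsSubdivision {α : Type*} (K : Set (Finset α))
    (S : Geometry.SimplicialComplex ℝ (α →₀ ℝ)) : Prop :=
  S.faces.Finite ∧ S.space = realization K ∧
    ∀ s ∈ S.faces, ∃ f ∈ K, convexHull ℝ (s : Set (α →₀ ℝ)) ⊆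
      convexHull ℝ ((fun v => Finsupp.single v (1 : ℝ)) '' (f : Set α))

/-- `K` and `L` are PL homeomorphic: they have simplicially isomorphic subdivisions.  The
isomorphism is given by the map `φ` on vertices. -/
def PLHomeomorphic {α β : Type*} (K : Set (Finset α)) (L : Set (Finset β)) : Prop :=
  ∃ (S : Geometry.SimplicialComplex ℝ (α →₀ ℝ)) (T : Geometry.SimplicialComplex ℝ (β →₀ ℝ)),
    IsSubdivision K S ∧ IsSubdivision L T ∧
    ∃ φ : (α →₀ ℝ) → (β →₀ ℝ), Set.InjOn φ S.vertices ∧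
      T.faces = {t : Finset (β →₀ ℝ) | ∃ s ∈ S.faces, (t : Set (β →₀ ℝ)) = φ '' (s : Set (α →₀ ℝ))}

/-- `B` is a PL `k`-ball: a simplicial complex that is PL homeomorphic to the abstract `k`-simplex,
the complex of all subsets of a set with `k + 1` elements. -/
def IsPLBall {α : Type*} (k : ℕ) (B : Set (Finset α)) : Prop :=
  IsLowerSet B ∧ PLHomeomorphic B (Set.univ : Set (Finset (Fin (k + 1))))

/-- The boundary complex of a PL ball: the faces whose link is a PL ball (of some dimension `≥ 0`;
the link `{∅}` of a facet is the `(-1)`-sphere, so facets are interior). -/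
def boundary {α : Type*} [DecidableEq α] (B : Set (Finset α)) : Set (Finset α) :=
  {f | f ∈ B ∧ ∃ k : ℕ, IsPLBall k (link B f)}

/-- A PL `d`-ball `B` is `k`-stacked: all its faces of dimension at most `d - k - 1` lie in the
boundary. A face `f` has dimension `f.card - 1`. -/
def IsStacked {α : Type*} [DecidableEq α] (d k : ℕ) (B : Set (Finset α)) : Prop :=
  ∀ f ∈ B, ((f.card : ℤ) - 1 ≤ (d : ℤ) - k - 1) → f ∈ boundary B

/-- `K` arises from the complex `L` on the vertex set `V` by a single element extension (in
dimension `d`) which adds the new vertex `w`. -/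
def IsSingleElementExtension {α : Type*} [DecidableEq α] (d : ℕ) (V : Finset α)
    (L : Set (Finset α)) (w : α) (K : Set (Finset α)) : Prop :=
  w ∉ V ∧ ∃ B : Set (Finset α), B ⊆ L ∧ IsPLBall d B ∧
    IsNeighborly ((d + 1) / 2 - 1) V B ∧ IsStacked d ((d + 1) / 2 - 1) B ∧
    K = (L \ B) ∪ join (boundary B) {∅, {w}}

/-! ### Cyclic polytopes -/

/-- `F` is a facet of the polytope `P`: a nonempty face whose dimension is one less than that
of `P`. -/
def IsFacet {E : Type*} [AddCommGroup E] [Module ℝ E] [TopologicalSpace E] (P F : Set E) : Prop :=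
  F.Nonempty ∧ IsExposed ℝ P F ∧
    Module.finrank ℝ (vectorSpan ℝ F) + 1 = Module.finrank ℝ (vectorSpan ℝ P)

/-- The facet hypergraph of a polytope: the vertex sets of its facets. -/
def polytopeFacets {E : Type*} [AddCommGroup E] [Module ℝ E] [TopologicalSpace E] (P : Set E) :
    Set (Finset E) :=
  {s | ∃ F : Set E, IsFacet P F ∧ (s : Set E) = F.extremePoints ℝ}

/-- The moment curve `t ↦ (t, t², …, t^d)`. -/
def momentCurve (d : ℕ) (t : ℝ) : Fin d → ℝ := fun i => t ^ ((i : ℕ) + 1)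

/-- The cyclic polytope with parameters `t 0, …, t (n - 1)`. -/
def cyclicPolytope (d : ℕ) {n : ℕ} (t : Fin n → ℝ) : Set (Fin d → ℝ) :=
  convexHull ℝ (Set.range fun i => momentCurve d (t i))

/-- The boundary complex of the cyclic polytope, with the vertex `γ(t i)` labelled by `i`. -/
def cyclicComplex (d : ℕ) {n : ℕ} (t : Fin n → ℝ) : Set (Finset (Fin n)) :=
  {s | ∃ g ∈ complexOf (polytopeFacets (cyclicPolytope d t)),
    (g : Set (Fin d → ℝ)) = (fun i => momentCurve d (t i)) '' (s : Set (Fin n))}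

end NeighborlySphere

/-! Color the vertices of the cyclic polytope by the parity of their index. Facets satisfy Gale's
evenness condition (`exists_gale_of_mem_cyclicComplex`), so a vertex other than the two endpoints
has an adjacent index in the same facet. A monochromatic facet would thus consist of endpoints only,
but facets have `d + 1 ≥ 3` vertices.

The new facets are `f ∪ {w}` with `f` a maximal boundary face of the ball, and `f` has exactly `d`
vertices (`IsPLBall.card_of_maximal_boundary`). It remains to choose a parity for `w` that no such
`f` has throughout (`exists_parity`). For `d ≥ 3` odd works: `f` misses one vertex of a Gale facet,
and evenness leaves a one-parity `f` at most one vertex besides the endpoints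
(`IsGale.interior_subsingleton`). Since index `0` is even, an all-odd `f` has at most two vertices.
For `d = 2` this bound is too weak, but the ball is then `0`-stacked, hence a single triangle
(`IsPLBall.eq_triangle_of_isStacked`), and some parity occurs at most once in it.

The topological input is derived by hand from the definition of PL homeomorphism: dimension, purity,
a codimension-one face in only one facet, and connectedness are read off a subdivision of the
standard simplex and carried across the isomorphism by counting vertices. -/

namespace NeighborlySphere

open Geometry

/-! ### Coordinates and linear algebra of simplices in a subdivision. -/

section Subdivision

variable {α : Type*}

/-- The sum of the coordinates. -/
noncomputable def coordSum (α : Type*) : (α →₀ ℝ) →ₗ[ℝ] ℝ :=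
  Finsupp.linearCombination ℝ (fun _ : α => (1 : ℝ))

lemma coordSum_single (v : α) (a : ℝ) : coordSum α (Finsupp.single v a) = a := by
  simp [coordSum]

lemma mem_convexHull_single_iff {f : Finset α} {x : α →₀ ℝ} :
    x ∈ convexHull ℝ ((fun v => Finsupp.single v (1 : ℝ)) '' (f : Set α)) ↔
      (∀ v, 0 ≤ x v) ∧ x.support ⊆ f ∧ coordSum α x = 1 := by
  classical
  constructor
  · intro hx
    have hconv : Convex ℝ {x : α →₀ ℝ | (∀ v, 0 ≤ x v) ∧ x.support ⊆ f ∧ coordSum α x = 1} := by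
      rintro x ⟨hx1, hx2, hx3⟩ y ⟨hy1, hy2, hy3⟩ a b ha hb hab
      refine ⟨fun v => ?_, fun v hv => ?_, ?_⟩
      · have := hx1 v
        have := hy1 v
        simp only [Finsupp.coe_add, Finsupp.coe_smul, Pi.add_apply, Pi.smul_apply, smul_eq_mul]
        positivity
      · by_contra hvf
        have h1 : x v = 0 := by
          by_contra h
          exact hvf (hx2 (Finsupp.mem_support_iff.2 h))
        have h2 : y v = 0 := by
          by_contra h
          exact hvf (hy2 (Finsupp.mem_support_iff.2 h))
        simp [h1, h2] at hv
      · simp [hx3, hy3, hab]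
    refine convexHull_min ?_ hconv hx
    rintro _ ⟨v, hv, rfl⟩
    refine ⟨fun u => ?_, ?_, coordSum_single v 1⟩
    · simp only [Finsupp.single_apply]
      split_ifs <;> norm_num
    · refine Finsupp.support_single_subset.trans ?_
      simpa using hv
  · rintro ⟨h1, h2, h3⟩
    have hx : x = ∑ v ∈ x.support, x v • Finsupp.single v (1 : ℝ) := by
      conv_lhs => rw [← Finsupp.sum_single x]
      simp [Finsupp.sum]
    rw [hx]
    refine (convex_convexHull ℝ _).sum_mem (fun v _ => h1 v) ?_ fun v hv => ?_
    · simpa [coordSum, Finsupp.linearCombination_apply, Finsupp.sum] using h3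
    · exact subset_convexHull ℝ _ ⟨v, h2 hv, rfl⟩

lemma mem_realization_iff {K : Set (Finset α)} (hK : IsLowerSet K) {x : α →₀ ℝ} :
    x ∈ realization K ↔ (∀ v, 0 ≤ x v) ∧ x.support ∈ K ∧ coordSum α x = 1 := by
  simp only [realization, Set.mem_iUnion, mem_convexHull_single_iff, exists_prop]
  constructor
  · rintro ⟨f, hf, h1, h2, h3⟩
    exact ⟨h1, hK h2 hf, h3⟩
  · rintro ⟨h1, h2, h3⟩
    exact ⟨_, h2, h1, subset_rfl, h3⟩

/-- The union of the supports of the vertices of a simplex. -/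
noncomputable def carrier (s : Finset (α →₀ ℝ)) : Finset α := by
  classical exact s.biUnion Finsupp.support

lemma mem_carrier {s : Finset (α →₀ ℝ)} {v : α} : v ∈ carrier s ↔ ∃ x ∈ s, x v ≠ 0 := by
  simp [carrier]

lemma support_subset_carrier {s : Finset (α →₀ ℝ)} {x : α →₀ ℝ} (hx : x ∈ s) :
    x.support ⊆ carrier s := fun _ hv => mem_carrier.2 ⟨x, hx, Finsupp.mem_support_iff.1 hv⟩

lemma carrier_mono {s t : Finset (α →₀ ℝ)} (h : s ⊆ t) : carrier s ⊆ carrier t := by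
  intro v hv
  obtain ⟨x, hx, hv⟩ := mem_carrier.1 hv
  exact mem_carrier.2 ⟨x, h hx, hv⟩

/-- `p` lies in the relative interior of the simplex spanned by `s`. -/
def InRelInterior {E : Type*} [AddCommGroup E] [Module ℝ E] (s : Finset E) (p : E) : Prop :=
  ∃ w : E → ℝ, (∀ v ∈ s, 0 < w v) ∧ ∑ v ∈ s, w v = 1 ∧ ∑ v ∈ s, w v • v = p

lemma InRelInterior.mem_convexHull {E : Type*} [AddCommGroup E] [Module ℝ E] {s : Finset E} {p : E}
    (h : InRelInterior s p) : p ∈ convexHull ℝ (s : Set E) := by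
  obtain ⟨w, hw, hw1, rfl⟩ := h
  exact (convex_convexHull ℝ _).sum_mem (fun v hv => (hw v hv).le) hw1
    fun v hv => subset_convexHull ℝ _ hv

lemma InRelInterior.mem_span {E : Type*} [AddCommGroup E] [Module ℝ E] {s : Finset E} {p : E}
    (h : InRelInterior s p) : p ∈ Submodule.span ℝ (s : Set E) := by
  obtain ⟨w, hw, hw1, rfl⟩ := h
  exact Submodule.sum_mem _ fun v hv => Submodule.smul_mem _ _ (Submodule.subset_span hv)

lemma exists_inRelInterior {E : Type*} [AddCommGroup E] [Module ℝ E] {s : Finset E}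
    (hs : s.Nonempty) : ∃ p, InRelInterior s p := by
  refine ⟨_, fun _ => (s.card : ℝ)⁻¹, fun _ _ => ?_, ?_, rfl⟩
  · have := hs.card_pos
    positivity
  · have : (s.card : ℝ) ≠ 0 := by exact_mod_cast hs.card_pos.ne'
    simp [this]

lemma InRelInterior.combo {E : Type*} [AddCommGroup E] [Module ℝ E] {s : Finset E} {p q : E}
    (hp : InRelInterior s p) (hq : InRelInterior s q) {a b : ℝ} (ha : 0 < a) (hb : 0 < b)
    (hab : a + b = 1) : InRelInterior s (a • p + b • q) := by
  obtain ⟨w, hw, hw1, rfl⟩ := hp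
  obtain ⟨u, hu, hu1, rfl⟩ := hq
  refine ⟨fun v => a * w v + b * u v, fun v hv => ?_, ?_, ?_⟩
  · have := hw v hv
    have := hu v hv
    positivity
  · rw [Finset.sum_add_distrib, ← Finset.mul_sum, ← Finset.mul_sum, hw1, hu1, mul_one, mul_one, hab]
  · simp only [add_smul, Finset.sum_add_distrib, mul_smul, Finset.smul_sum]

lemma exists_subset_inRelInterior {E : Type*} [AddCommGroup E] [Module ℝ E] {s : Finset E} {p : E}
    (h : p ∈ convexHull ℝ (s : Set E)) : ∃ t ⊆ s, InRelInterior t p := by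
  classical
  obtain ⟨w, hw0, hw1, hp⟩ := Finset.mem_convexHull'.1 h
  refine ⟨s.filter fun v => w v ≠ 0, Finset.filter_subset _ _, w, fun v hv => ?_, ?_, ?_⟩
  · rw [Finset.mem_filter] at hv
    exact lt_of_le_of_ne (hw0 v hv.1) hv.2.symm
  · rw [Finset.sum_filter_ne_zero, hw1]
  · rw [← hp, Finset.sum_filter]
    refine Finset.sum_congr rfl fun v _ => ?_
    split_ifs with h
    · rfl
    · rw [not_not.1 h, zero_smul]

lemma InRelInterior.nonempty {E : Type*} [AddCommGroup E] [Module ℝ E] {s : Finset E} {p : E}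
    (h : InRelInterior s p) : s.Nonempty := by
  obtain ⟨w, -, hw1, -⟩ := h
  by_contra hs
  rw [Finset.not_nonempty_iff_eq_empty] at hs
  simp [hs] at hw1

/-- The two simplices meet in the hull of their common vertices, so `x` has a second expression over
`s` using only vertices in `ρ`. Independence identifies it with the first, whose weights are all
positive. -/
lemma InRelInterior.subset_of_mem {E : Type*} [AddCommGroup E] [Module ℝ E]
    {S : SimplicialComplex ℝ E} {s ρ : Finset E} {x : E} (hs : s ∈ S.faces) (hρ : ρ ∈ S.faces)
    (hli : LinearIndependent ℝ ((↑) : s → E)) (hx : InRelInterior s x)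
    (hxρ : x ∈ convexHull ℝ (ρ : Set E)) : s ⊆ ρ := by
  classical
  have h := S.inter_subset_convexHull hs hρ ⟨hx.mem_convexHull, hxρ⟩
  rw [← Finset.coe_inter] at h
  obtain ⟨u, -, -, hu⟩ := Finset.mem_convexHull'.1 h
  obtain ⟨w, hw, -, rfl⟩ := hx
  intro v hv
  by_contra hvρ
  have key : ∑ y ∈ s, (w y - if y ∈ ρ then u y else 0) • y = 0 := by
    simp only [sub_smul, Finset.sum_sub_distrib, ite_smul, zero_smul]
    rw [← Finset.sum_filter, Finset.filter_mem_eq_inter, hu, sub_self]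
  have := linearIndepOn_finset_iff.1 (show LinearIndepOn ℝ id (s : Set E) from hli) _ key v hv
  simp only [hvρ, if_false, sub_zero] at this
  exact (hw v hv).ne' this

variable {K : Set (Finset α)} {S : SimplicialComplex ℝ (α →₀ ℝ)}

lemma IsSubdivision.nonneg (hS : IsSubdivision K S) {s : Finset (α →₀ ℝ)} (hs : s ∈ S.faces)
    {x : α →₀ ℝ} (hx : x ∈ s) (v : α) : 0 ≤ x v := by
  obtain ⟨f, -, h⟩ := hS.2.2 s hs
  exact (mem_convexHull_single_iff.1 (h (subset_convexHull ℝ _ hx))).1 v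

lemma IsSubdivision.coordSum_eq (hS : IsSubdivision K S) {s : Finset (α →₀ ℝ)} (hs : s ∈ S.faces)
    {x : α →₀ ℝ} (hx : x ∈ s) : coordSum α x = 1 := by
  obtain ⟨f, -, h⟩ := hS.2.2 s hs
  exact (mem_convexHull_single_iff.1 (h (subset_convexHull ℝ _ hx))).2.2

lemma IsSubdivision.carrier_mem (hS : IsSubdivision K S) (hK : IsLowerSet K)
    {s : Finset (α →₀ ℝ)} (hs : s ∈ S.faces) : carrier s ∈ K := by
  obtain ⟨f, hf, h⟩ := hS.2.2 s hs
  refine hK (fun v hv => ?_) hf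
  obtain ⟨x, hx, hv⟩ := mem_carrier.1 hv
  exact (mem_convexHull_single_iff.1 (h (subset_convexHull ℝ _ hx))).2.1
    (Finsupp.mem_support_iff.2 hv)

/-- All vertices lie in the hyperplane where the coordinates sum to one, which misses the origin.
Affine independence there is linear independence, so dimensions can be counted with spans. -/
lemma IsSubdivision.linearIndependent (hS : IsSubdivision K S) {s : Finset (α →₀ ℝ)}
    (hs : s ∈ S.faces) : LinearIndependent ℝ ((↑) : s → α →₀ ℝ) := by
  classical
  rw [linearIndependent_iff']
  intro t g hg
  refine affineIndependent_iff.1 (S.indep hs) t g ?_ hg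
  have := congrArg (coordSum α) hg
  rw [map_sum, map_zero] at this
  rw [← this]
  refine Finset.sum_congr rfl fun x _ => ?_
  rw [map_smul, hS.coordSum_eq hs x.2, smul_eq_mul, mul_one]

/-- Coordinates are nonnegative and weights positive, so nothing cancels. -/
lemma IsSubdivision.support_eq_carrier (hS : IsSubdivision K S) {s : Finset (α →₀ ℝ)}
    (hs : s ∈ S.faces) {p : α →₀ ℝ} (hp : InRelInterior s p) : p.support = carrier s := by
  obtain ⟨w, hw, -, rfl⟩ := hp
  ext v
  rw [Finsupp.mem_support_iff, mem_carrier, Finsupp.finsetSum_apply]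
  have h0 : ∀ x ∈ s, 0 ≤ (w x • x) v := fun x hx =>
    mul_nonneg (hw x hx).le (hS.nonneg hs hx v)
  rw [Ne, Finset.sum_eq_zero_iff_of_nonneg h0]
  push Not
  refine exists_congr fun x => and_congr_right fun hx => ?_
  simp [(hw x hx).ne']

lemma IsSubdivision.exists_inRelInterior (hS : IsSubdivision K S) {p : α →₀ ℝ}
    (hp : p ∈ realization K) : ∃ s ∈ S.faces, InRelInterior s p := by
  rw [← hS.2.1] at hp
  obtain ⟨s, hs, hp⟩ := SimplicialComplex.mem_space_iff.1 hp
  obtain ⟨t, hts, ht⟩ := exists_subset_inRelInterior hp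
  exact ⟨t, S.down_closed hs hts ht.nonempty, ht⟩

lemma coe_mem_span {s : Finset (α →₀ ℝ)} {g : Finset α} (h : carrier s ⊆ g) :
    Submodule.span ℝ (s : Set (α →₀ ℝ)) ≤
      Submodule.span ℝ ((fun v => Finsupp.single v (1 : ℝ)) '' (g : Set α)) := by
  rw [Submodule.span_le]
  intro x hx
  rw [SetLike.mem_coe, ← Finsupp.supported_eq_span_single, Finsupp.mem_supported]
  exact_mod_cast (support_subset_carrier hx).trans h

lemma finrank_span_single (g : Finset α) :
    Module.finrank ℝ (Submodule.span ℝ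
      ((fun v => Finsupp.single v (1 : ℝ)) '' (g : Set α))) = g.card := by
  classical
  have hinj : Function.Injective fun v : α => Finsupp.single v (1 : ℝ) :=
    Finsupp.single_left_injective one_ne_zero
  rw [← Finset.coe_image, finrank_span_finset_eq_card, Finset.card_image_of_injective _ hinj]
  have h := (Finsupp.linearIndependent_single_one ℝ α)
  have h2 : LinearIndepOn ℝ id (Set.range fun v : α => Finsupp.single v (1 : ℝ)) :=
    h.linearIndepOn_id
  exact h2.mono (by simp)

lemma IsSubdivision.finrank_span (hS : IsSubdivision K S) {s : Finset (α →₀ ℝ)}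
    (hs : s ∈ S.faces) : Module.finrank ℝ (Submodule.span ℝ (s : Set (α →₀ ℝ))) = s.card :=
  finrank_span_finset_eq_card (hS.linearIndependent hs)

lemma IsSubdivision.card_le (hS : IsSubdivision K S) {s : Finset (α →₀ ℝ)}
    (hs : s ∈ S.faces) {g : Finset α} (h : carrier s ⊆ g) : s.card ≤ g.card := by
  rw [← hS.finrank_span hs, ← finrank_span_single g]
  have : FiniteDimensional ℝ (Submodule.span ℝ
      ((fun v => Finsupp.single v (1 : ℝ)) '' (g : Set α))) :=
    FiniteDimensional.span_of_finite ℝ (g.finite_toSet.image _)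
  exact Submodule.finrank_mono (coe_mem_span h)

lemma IsSubdivision.exists_single_notMem_span (hS : IsSubdivision K S) {s : Finset (α →₀ ℝ)}
    (hs : s ∈ S.faces) {g : Finset α} (h : s.card < g.card) :
    ∃ v ∈ g, Finsupp.single v (1 : ℝ) ∉ Submodule.span ℝ (s : Set (α →₀ ℝ)) := by
  by_contra! hcon
  rw [← hS.finrank_span hs, ← finrank_span_single g] at h
  refine h.not_ge (Submodule.finrank_mono (Submodule.span_le.2 ?_))
  rintro _ ⟨v, hv, rfl⟩
  exact hcon v hv

/-- The product topology on `α → ℝ` makes finite convex hulls closed, even for infinite `α`. -/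
lemma isClosed_line_convexHull (s : Finset (α →₀ ℝ)) (x u : α →₀ ℝ) :
    IsClosed {a : ℝ | x + a • u ∈ convexHull ℝ (s : Set (α →₀ ℝ))} := by
  let L : (α →₀ ℝ) →ₗ[ℝ] (α → ℝ) := Finsupp.lcoeFun
  have hL : Function.Injective L := DFunLike.coe_injective
  have h1 : IsClosed (convexHull ℝ (L '' (s : Set (α →₀ ℝ)))) :=
    (s.finite_toSet.image L).isClosed_convexHull (𝕜 := ℝ)
  have h2 : Continuous fun a : ℝ => L x + a • L u := by fun_prop
  convert h1.preimage h2 using 1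
  ext a
  simp only [Set.mem_ofPred_eq, Set.mem_preimage]
  rw [← L.isLinear.image_convexHull, ← map_smul, ← map_add, hL.mem_set_image]

/-- Near an interior point `x` of the simplex `s`, the points of a segment that starts at `x` lie in
the relative interior of a simplex which contains `s`. -/
lemma IsSubdivision.exists_direction (hS : IsSubdivision K S) {s : Finset (α →₀ ℝ)}
    (hs : s ∈ S.faces) {x u : α →₀ ℝ} (hx : InRelInterior s x)
    (hu : ∀ a : ℝ, 0 < a → a ≤ 1 → x + a • u ∈ realization K) :
    ∃ ρ ∈ S.faces, s ⊆ ρ ∧ ∃ a : ℝ, 0 < a ∧ a ≤ 1 ∧ InRelInterior ρ (x + a • u) := by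
  have ha : ∀ n : ℕ, 0 < 1 / ((n : ℝ) + 1) ∧ 1 / ((n : ℝ) + 1) ≤ 1 := fun n =>
    ⟨by positivity, by rw [div_le_one (by positivity)]; linarith [(n.cast_nonneg : (0 : ℝ) ≤ n)]⟩
  choose ρ hρS hρ using fun n : ℕ => hS.exists_inRelInterior (hu _ (ha n).1 (ha n).2)
  have hfin : Finite S.faces := hS.1
  -- Pigeonhole: one simplex `τ` contains infinitely many of the points with parameter `1 / (n +
  -- 1)`, so by closedness it also contains their limit `x`.
  obtain ⟨⟨τ, hτ⟩, hinf⟩ := Finite.exists_infinite_fiber fun n : ℕ => (⟨ρ n, hρS n⟩ : S.faces)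
  rw [Set.infinite_coe_iff] at hinf
  have hinf' : ∃ᶠ n in Filter.atTop, ρ n = τ := by
    rw [Nat.frequently_atTop_iff_infinite]
    refine hinf.mono fun n hn => ?_
    simpa using hn
  have hmem : (0 : ℝ) ∈ {a : ℝ | x + a • u ∈ convexHull ℝ (τ : Set (α →₀ ℝ))} := by
    refine (isClosed_line_convexHull τ x u).mem_of_frequently_of_tendsto
      (hinf'.mono fun n hn => ?_) tendsto_one_div_add_atTop_nhds_zero_nat
    rw [← hn]
    exact (hρ n).mem_convexHull
  obtain ⟨n, hn⟩ := hinf'.exists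
  refine ⟨τ, hτ, ?_, _, (ha n).1, (ha n).2, hn ▸ hρ n⟩
  refine hx.subset_of_mem hs hτ (hS.linearIndependent hs) ?_
  simpa using hmem

end Subdivision

/-! ### Enlarging a simplex within a face. -/

section Subdivision

variable {α : Type*} {K : Set (Finset α)} {S : SimplicialComplex ℝ (α →₀ ℝ)}

lemma IsSubdivision.mem_convexHull_single (hS : IsSubdivision K S) {s : Finset (α →₀ ℝ)}
    (hs : s ∈ S.faces) {g : Finset α} (hsg : carrier s ⊆ g) {x : α →₀ ℝ}
    (hx : InRelInterior s x) :
    x ∈ convexHull ℝ ((fun v => Finsupp.single v (1 : ℝ)) '' (g : Set α)) := by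
  refine convexHull_min ?_ (convex_convexHull ℝ _) hx.mem_convexHull
  intro y hy
  exact mem_convexHull_single_iff.2
    ⟨hS.nonneg hs hy, (support_subset_carrier hy).trans hsg, hS.coordSum_eq hs hy⟩

lemma IsSubdivision.exists_direction_of_face (hS : IsSubdivision K S) {s : Finset (α →₀ ℝ)}
    (hs : s ∈ S.faces) {g : Finset α} (hg : g ∈ K) (hsg : carrier s ⊆ g) {x u : α →₀ ℝ}
    (hx : InRelInterior s x)
    (hu : x + u ∈ convexHull ℝ ((fun v => Finsupp.single v (1 : ℝ)) '' (g : Set α))) :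
    ∃ ρ ∈ S.faces, s ⊆ ρ ∧ carrier ρ ⊆ g ∧ ∃ a : ℝ, 0 < a ∧ InRelInterior ρ (x + a • u) := by
  have hmem : ∀ a : ℝ, 0 < a → a ≤ 1 →
      x + a • u ∈ convexHull ℝ ((fun v => Finsupp.single v (1 : ℝ)) '' (g : Set α)) := by
    intro a ha0 ha1
    have := (convex_convexHull ℝ ((fun v => Finsupp.single v (1 : ℝ)) '' (g : Set α)))
      (hS.mem_convexHull_single hs hsg hx) hu (sub_nonneg.2 ha1) ha0.le (by ring)
    convert this using 1
    module
  obtain ⟨ρ, hρ, hsρ, a, ha0, ha1, ha⟩ := hS.exists_direction hs hx fun a h0 h1 =>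
    Set.mem_iUnion₂.2 ⟨g, hg, hmem a h0 h1⟩
  refine ⟨ρ, hρ, hsρ, ?_, a, ha0, ha⟩
  rw [← hS.support_eq_carrier hρ ha]
  exact (mem_convexHull_single_iff.1 (hmem a ha0 ha1)).2.1

lemma mem_span_of_direction {E : Type*} [AddCommGroup E] [Module ℝ E] {W : Submodule ℝ E}
    {x y : E} {a : ℝ} (ha : a ≠ 0) (hx : x ∈ W) (h : x + a • (y - x) ∈ W) : y ∈ W := by
  have h1 := W.smul_mem a⁻¹ (W.sub_mem h hx)
  rw [add_sub_cancel_left, inv_smul_smul₀ ha] at h1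
  simpa using W.add_mem h1 hx

lemma single_mem_convexHull_single {g : Finset α} {v : α} (hv : v ∈ g) :
    Finsupp.single v (1 : ℝ) ∈
      convexHull ℝ ((fun v => Finsupp.single v (1 : ℝ)) '' (g : Set α)) :=
  subset_convexHull ℝ _ ⟨v, hv, rfl⟩

/-- Move from an interior point of `s` towards a vertex of `g` outside the span of `s`: the simplex
entered contains `s` and cannot be `s`. -/
lemma IsSubdivision.exists_ssubset_face (hS : IsSubdivision K S) {s : Finset (α →₀ ℝ)}
    (hs : s ∈ S.faces) {g : Finset α} (hg : g ∈ K) (hsg : carrier s ⊆ g)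
    (hcard : s.card < g.card) : ∃ ρ ∈ S.faces, s ⊂ ρ ∧ carrier ρ ⊆ g := by
  obtain ⟨v, hv, hvs⟩ := hS.exists_single_notMem_span hs hcard
  obtain ⟨x, hx⟩ := NeighborlySphere.exists_inRelInterior (S.nonempty_of_mem_faces hs)
  obtain ⟨ρ, hρ, hsρ, hρg, a, ha, hp⟩ :=
    hS.exists_direction_of_face hs hg hsg (u := Finsupp.single v 1 - x) hx
      (by simpa using single_mem_convexHull_single hv)
  refine ⟨ρ, hρ, hsρ.ssubset_of_ne ?_, hρg⟩
  rintro rfl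
  exact hvs (mem_span_of_direction ha.ne' hx.mem_span hp.mem_span)

lemma IsSubdivision.exists_full_face (hS : IsSubdivision K S) {s : Finset (α →₀ ℝ)}
    (hs : s ∈ S.faces) {g : Finset α} (hg : g ∈ K) (hsg : carrier s ⊆ g) :
    ∃ ρ ∈ S.faces, s ⊆ ρ ∧ carrier ρ = g ∧ ρ.card = g.card := by
  induction hn : g.card - s.card using Nat.strong_induction_on generalizing s with
  | _ n ih =>
    rcases (hS.card_le hs hsg).eq_or_lt with h | h
    · refine ⟨s, hs, subset_rfl, Finset.eq_of_subset_of_card_le hsg ?_, h⟩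
      rw [← h]
      exact hS.card_le hs subset_rfl
    · obtain ⟨ρ, hρ, hsρ, hρg⟩ := hS.exists_ssubset_face hs hg hsg h
      have := Finset.card_lt_card hsρ
      obtain ⟨ρ', h1, h2, h3⟩ := ih _ (by omega) hρ hρg rfl
      exact ⟨ρ', h1, hsρ.subset.trans h2, h3⟩

lemma IsSubdivision.exists_face_carrier_eq (hS : IsSubdivision K S) {f : Finset α}
    (hf : f ∈ K) (hne : f.Nonempty) :
    ∃ s ∈ S.faces, carrier s = f ∧ s.card = f.card := by
  classical
  obtain ⟨v, hv⟩ := hne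
  obtain ⟨s, hs, hsv⟩ := hS.exists_inRelInterior (p := Finsupp.single v 1)
    (Set.mem_iUnion₂.2 ⟨f, hf, single_mem_convexHull_single hv⟩)
  obtain ⟨ρ, h1, -, h3⟩ := hS.exists_full_face hs hf (by
    rw [← hS.support_eq_carrier hs hsv]
    exact Finsupp.support_single_subset.trans (by simpa using hv))
  exact ⟨ρ, h1, h3⟩

/-- A simplex of codimension one that meets the interior of a face lies in two full-dimensional
simplices of that face. -/
lemma IsSubdivision.exists_pair_of_card_succ (hS : IsSubdivision K S) (hK : IsLowerSet K)
    {s : Finset (α →₀ ℝ)} (hs : s ∈ S.faces) (hcard : s.card + 1 = (carrier s).card) :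
    ∃ ρ ∈ S.faces, ∃ ρ' ∈ S.faces, s ⊆ ρ ∧ s ⊆ ρ' ∧ ρ.card = s.card + 1 ∧
      ρ'.card = s.card + 1 ∧ ρ ≠ ρ' := by
  classical
  obtain ⟨v, hv, hvs⟩ := hS.exists_single_notMem_span hs (g := carrier s) (by omega)
  obtain ⟨x, hx⟩ := NeighborlySphere.exists_inRelInterior (S.nonempty_of_mem_faces hs)
  have hc := hS.carrier_mem hK hs
  have hxsupp := hS.support_eq_carrier hs hx
  obtain ⟨hx0, -, hx1⟩ := mem_convexHull_single_iff.1 (hS.mem_convexHull_single hs subset_rfl hx)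
  have hxv : 0 < x v := (hx0 v).lt_of_ne' (Finsupp.mem_support_iff.1 (hxsupp ▸ hv))
  -- A step away from `v` of relative length `x v` stays in the face: the `v`-coordinate becomes `(x
  -- v) ^ 2`, the others `(1 + x v) * x i`.
  have hback : x + (-(x v)) • (Finsupp.single v 1 - x) ∈
      convexHull ℝ ((fun v => Finsupp.single v (1 : ℝ)) '' (carrier s : Set α)) := by
    refine mem_convexHull_single_iff.2 ⟨fun i => ?_, fun i hi => ?_, ?_⟩
    · have := mul_nonneg (hx0 v) (hx0 i)
      have := hx0 i
      by_cases hiv : v = i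
      · subst hiv
        simp
        nlinarith
      · simp [hiv]
        nlinarith
    · by_contra hic
      have hxi : x i = 0 := by
        rw [← hxsupp] at hic
        exact Finsupp.notMem_support_iff.1 hic
      have hiv : v ≠ i := fun h => hic (h ▸ hv)
      simp [hxi, hiv] at hi
    · rw [map_add, map_smul, map_sub, hx1, coordSum_single]
      simp
  obtain ⟨ρ, hρ, hsρ, hρc, a, ha, hp⟩ :=
    hS.exists_direction_of_face hs hc subset_rfl (u := Finsupp.single v 1 - x) hx
      (by simpa using single_mem_convexHull_single hv)
  obtain ⟨ρ', hρ', hsρ', hρc', b, hb, hp'⟩ :=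
    hS.exists_direction_of_face hs hc subset_rfl hx hback
  rw [smul_smul] at hp'
  have hne : ∀ {τ : Finset (α →₀ ℝ)} {t : ℝ}, t ≠ 0 →
      InRelInterior τ (x + t • (Finsupp.single v 1 - x)) → s ≠ τ := by
    rintro τ t ht hτ rfl
    exact hvs (mem_span_of_direction ht hx.mem_span hτ.mem_span)
  have hcardρ : ∀ {τ : Finset (α →₀ ℝ)}, τ ∈ S.faces → s ⊆ τ → s ≠ τ → carrier τ ⊆ carrier s →
      τ.card = s.card + 1 := by
    intro τ hτ h1 h2 h3
    have := Finset.card_lt_card (h1.ssubset_of_ne h2)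
    have := hS.card_le hτ h3
    omega
  have hb' : 0 < b * x v := mul_pos hb hxv
  have hsneρ := hne ha.ne' hp
  refine ⟨ρ, hρ, ρ', hρ', hsρ, hsρ', hcardρ hρ hsρ hsneρ hρc,
    hcardρ hρ' hsρ' (hne (by nlinarith) hp') hρc', ?_⟩
  rintro rfl
  -- If both sides met the same simplex `ρ`, then `x`, a positive combination of the two points,
  -- would be interior to `ρ`. As `x` lies in `s`, this forces `ρ = s`.
  have hmid := hp.combo hp' (a := b * x v / (a + b * x v)) (b := a / (a + b * x v))
    (by positivity) (by positivity) (by field_simp; ring)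
  have hxeq : (b * x v / (a + b * x v)) • (x + a • (Finsupp.single v 1 - x)) +
      (a / (a + b * x v)) • (x + (b * -x v) • (Finsupp.single v 1 - x)) = x := by
    have h1 : b * x v / (a + b * x v) + a / (a + b * x v) = 1 := by field_simp; ring
    have h2 : b * x v / (a + b * x v) * a + a / (a + b * x v) * (b * -x v) = 0 := by
      field_simp; ring
    calc _ = (b * x v / (a + b * x v) + a / (a + b * x v)) • x +
          (b * x v / (a + b * x v) * a + a / (a + b * x v) * (b * -x v)) •
            (Finsupp.single v 1 - x) := by module
      _ = x := by rw [h1, h2, one_smul, zero_smul, add_zero]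
  rw [hxeq] at hmid
  exact hsneρ (hsρ.antisymm
    (hmid.subset_of_mem hρ hs (hS.linearIndependent hρ) hx.mem_convexHull))

end Subdivision

/-- In a subdivision of a simplex, a full-dimensional simplex of a boundary facet lies in only one
full-dimensional simplex. -/
lemma IsSubdivision.eq_of_boundary {k : ℕ} {T : SimplicialComplex ℝ (Fin (k + 1) →₀ ℝ)}
    (hT : IsSubdivision (Set.univ : Set (Finset (Fin (k + 1)))) T)
    {τ ρ ρ' : Finset (Fin (k + 1) →₀ ℝ)} (hτ : τ ∈ T.faces) (hcard : τ.card = k)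
    (h0 : (0 : Fin (k + 1)) ∉ carrier τ) (hρ : ρ ∈ T.faces) (hρ' : ρ' ∈ T.faces) (hτρ : τ ⊆ ρ)
    (hτρ' : τ ⊆ ρ') (hcρ : ρ.card = k + 1) (hcρ' : ρ'.card = k + 1) : ρ = ρ' := by
  classical
  -- A full-dimensional simplex over `τ` adds one apex off the facet opposite `0`, since that facet
  -- has room for only `k` independent vertices.
  have key : ∀ σ ∈ T.faces, τ ⊆ σ → σ.card = k + 1 → ∃ a, a ∉ τ ∧ σ = insert a τ ∧ 0 < a 0 := by
    intro σ hσ hτσ hc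
    obtain ⟨a, ha, rfl⟩ : ∃ a, a ∉ τ ∧ insert a τ = σ := by
      have := Finset.card_sdiff_of_subset hτσ
      obtain ⟨a, ha⟩ := Finset.card_eq_one.1 (show (σ \ τ).card = 1 by omega)
      refine ⟨a, ?_, ?_⟩
      · exact (Finset.mem_sdiff.1 (ha ▸ Finset.mem_singleton_self a)).2
      · rw [Finset.insert_eq, ← ha, Finset.sdiff_union_of_subset hτσ]
    refine ⟨a, ha, rfl, (hT.nonneg hσ (Finset.mem_insert_self _ _) 0).lt_of_ne' fun ha0 => ?_⟩
    have := hT.card_le hσ (g := Finset.univ.erase 0) (by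
      intro v hv
      refine Finset.mem_erase.2 ⟨?_, Finset.mem_univ _⟩
      rintro rfl
      obtain ⟨y, hy, hy0⟩ := mem_carrier.1 hv
      rcases Finset.mem_insert.1 hy with rfl | hy
      · exact hy0 ha0
      · exact h0 (mem_carrier.2 ⟨y, hy, hy0⟩))
    rw [hc, Finset.card_erase_of_mem (Finset.mem_univ _), Finset.card_univ, Fintype.card_fin] at this
    omega
  obtain ⟨a, haτ, rfl, ha0⟩ := key ρ hρ hτρ hcρ
  obtain ⟨b, hbτ, rfl, hb0⟩ := key ρ' hρ' hτρ' hcρ'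
  have hspan : Submodule.span ℝ ((insert a τ : Finset _) : Set (Fin (k + 1) →₀ ℝ)) = ⊤ := by
    refine Submodule.eq_top_of_finrank_eq ?_
    rw [hT.finrank_span hρ, hcρ]
    simp
  have hbspan : b ∈ Submodule.span ℝ ((insert a τ : Finset _) : Set (Fin (k + 1) →₀ ℝ)) :=
    hspan ▸ Submodule.mem_top
  obtain ⟨l, -, hl⟩ := Submodule.mem_span_finset.1 hbspan
  rw [Finset.sum_insert haτ] at hl
  -- In the `0`-coordinate only the apex terms survive, so both apexes lie on the same side of `τ`.
  have hla : 0 < l a := by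
    have h1 := congrArg (fun y : Fin (k + 1) →₀ ℝ => y 0) hl
    have h2 : ∀ y ∈ τ, l y * y 0 = 0 := fun y hy => by
      have : y 0 = 0 := by
        by_contra h
        exact h0 (mem_carrier.2 ⟨y, hy, h⟩)
      simp [this]
    simp only [Finsupp.add_apply, Finsupp.finsetSum_apply, Finsupp.smul_apply,
      smul_eq_mul, Finset.sum_eq_zero h2, add_zero] at h1
    by_contra h
    nlinarith
  obtain ⟨x, hx⟩ := NeighborlySphere.exists_inRelInterior (T.nonempty_of_mem_faces hτ)
  have hxhull := convexHull_mono (Finset.coe_subset.2 hτρ') hx.mem_convexHull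
  obtain ⟨w, hw, hw1, hwx⟩ := hx
  -- A point slightly off `x` towards `b` keeps positive weights on `insert a τ`, yet lies in
  -- `insert b τ`, so the first simplex is contained in the second.
  obtain ⟨ε, hε0, hε1, hε⟩ : ∃ ε : ℝ, 0 < ε ∧ ε < 1 ∧ ∀ y ∈ τ, 0 < (1 - ε) * w y + ε * l y := by
    have h1 : ∀ y ∈ τ, ∀ᶠ ε in nhdsWithin (0 : ℝ) (Set.Ioi 0), 0 < (1 - ε) * w y + ε * l y := by
      intro y hy
      have hc : Continuous fun ε : ℝ => (1 - ε) * w y + ε * l y := by fun_prop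
      exact (hc.tendsto' 0 (w y) (by simp)).eventually_const_lt (hw y hy) |>.filter_mono
        nhdsWithin_le_nhds
    have h2 : ∀ᶠ ε in nhdsWithin (0 : ℝ) (Set.Ioi 0), ε ∈ Set.Ioo (0 : ℝ) 1 :=
      Ioo_mem_nhdsGT one_pos
    obtain ⟨ε, h3, h4⟩ := (((Filter.eventually_all_finset τ).2 h1).and h2).exists
    exact ⟨ε, h4.1, h4.2, h3⟩
  have hsum : (1 : ℝ) = l a + ∑ y ∈ τ, l y := by
    have h1 := congrArg (coordSum (Fin (k + 1))) hl
    rw [map_add, map_smul, map_sum, hT.coordSum_eq hρ' (Finset.mem_insert_self _ _),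
      hT.coordSum_eq hρ (Finset.mem_insert_self _ _)] at h1
    rw [← h1, smul_eq_mul, mul_one]
    congr 1
    refine Finset.sum_congr rfl fun y hy => ?_
    rw [map_smul, hT.coordSum_eq hτ hy, smul_eq_mul, mul_one]
  have hin : InRelInterior (insert a τ) ((1 - ε) • x + ε • b) := by
    refine ⟨fun y => if y = a then ε * l a else (1 - ε) * w y + ε * l y, fun y hy => ?_, ?_, ?_⟩
    · dsimp only
      split_ifs with h
      · positivity
      · exact hε y ((Finset.mem_insert.1 hy).resolve_left h)
    · rw [Finset.sum_insert haτ, if_pos rfl, Finset.sum_congr rfl fun y hy =>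
        if_neg (ne_of_mem_of_not_mem hy haτ), Finset.sum_add_distrib, ← Finset.mul_sum,
        ← Finset.mul_sum, hw1]
      linear_combination -ε * hsum
    · rw [Finset.sum_insert haτ]
      dsimp only
      rw [if_pos rfl, Finset.sum_congr rfl fun y hy => by
        rw [if_neg (ne_of_mem_of_not_mem hy haτ)], ← hl, ← hwx]
      simp only [add_smul, Finset.sum_add_distrib, mul_smul, ← Finset.smul_sum, smul_add]
      abel
  have hsub := hin.subset_of_mem hρ hρ' (hT.linearIndependent hρ)
    ((convex_convexHull ℝ _) hxhull
      (subset_convexHull ℝ _ (Finset.mem_coe.2 (Finset.mem_insert_self b τ)))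
      (sub_nonneg.2 hε1.le) hε0.le (by ring))
  exact Finset.eq_of_subset_of_card_le hsub (by omega)

/-- `φ` induces an isomorphism from `S` to `T`. -/
def IsFaceIso {E F : Type*} [AddCommGroup E] [Module ℝ E] [AddCommGroup F] [Module ℝ F]
    (S : SimplicialComplex ℝ E) (T : SimplicialComplex ℝ F) (φ : E → F) : Prop :=
  Set.InjOn φ S.vertices ∧
    T.faces = {t : Finset F | ∃ s ∈ S.faces, (t : Set F) = φ '' (s : Set E)}

/-! ### Transport of faces along a simplicial isomorphism. -/

section FaceIso

variable {E F : Type*} [AddCommGroup E] [Module ℝ E] [AddCommGroup F] [Module ℝ F]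
  {S : SimplicialComplex ℝ E} {T : SimplicialComplex ℝ F} {φ : E → F}

lemma mem_vertices_of_mem {s : Finset E} (hs : s ∈ S.faces) {x : E} (hx : x ∈ s) :
    x ∈ S.vertices := by
  rw [SimplicialComplex.vertices_eq]
  exact Set.mem_iUnion₂.2 ⟨s, hs, hx⟩

lemma IsFaceIso.image_mem [DecidableEq F] (h : IsFaceIso S T φ) {s : Finset E} (hs : s ∈ S.faces) :
    s.image φ ∈ T.faces := by
  rw [h.2]
  exact ⟨s, hs, by simp⟩

lemma IsFaceIso.exists_eq_image [DecidableEq F] (h : IsFaceIso S T φ) {t : Finset F}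
    (ht : t ∈ T.faces) : ∃ s ∈ S.faces, s.image φ = t := by
  rw [h.2] at ht
  obtain ⟨s, hs, hts⟩ := ht
  exact ⟨s, hs, Finset.coe_injective (by rw [hts, Finset.coe_image])⟩

lemma IsFaceIso.card_image [DecidableEq F] (h : IsFaceIso S T φ) {s : Finset E} (hs : s ∈ S.faces) :
    (s.image φ).card = s.card :=
  Finset.card_image_of_injOn (h.1.mono fun _ hx => mem_vertices_of_mem hs hx)

lemma IsFaceIso.subset_of_image_subset [DecidableEq F] (h : IsFaceIso S T φ) {s s' : Finset E}
    (hs : s ∈ S.faces) (hs' : s' ∈ S.faces) (hss : s.image φ ⊆ s'.image φ) : s ⊆ s' := by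
  intro x hx
  obtain ⟨y, hy, hyx⟩ := Finset.mem_image.1 (hss (Finset.mem_image_of_mem φ hx))
  rwa [← h.1 (mem_vertices_of_mem hs' hy) (mem_vertices_of_mem hs hx) hyx]

end FaceIso

/-! ### Dimension, purity, free faces and connectedness of PL balls. -/

section Ball

variable {α : Type*} {k : ℕ} {M : Set (Finset α)}

lemma IsPLBall.exists_faceIso (hM : IsPLBall k M) :
    ∃ (S : SimplicialComplex ℝ (α →₀ ℝ)) (T : SimplicialComplex ℝ (Fin (k + 1) →₀ ℝ))
      (φ : (α →₀ ℝ) → Fin (k + 1) →₀ ℝ), IsSubdivision M S ∧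
      IsSubdivision (Set.univ : Set (Finset (Fin (k + 1)))) T ∧ IsFaceIso S T φ := by
  obtain ⟨-, S, T, hS, hT, φ, h1, h2⟩ := hM
  exact ⟨S, T, φ, hS, hT, h1, h2⟩

lemma IsPLBall.card_le (hM : IsPLBall k M) {f : Finset α} (hf : f ∈ M) : f.card ≤ k + 1 := by
  classical
  obtain ⟨S, T, φ, hS, hT, hφ⟩ := hM.exists_faceIso
  rcases f.eq_empty_or_nonempty with rfl | hne
  · simp
  obtain ⟨s, hs, -, hcard⟩ := hS.exists_face_carrier_eq hf hne
  rw [← hcard, ← hφ.card_image hs]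
  exact (hT.card_le (hφ.image_mem hs) (Finset.subset_univ _)).trans (by simp)

/-- A simplex filling `f` has an image with fewer than `k + 1` vertices, so it can be enlarged in
`T`. The larger simplex pulled back no longer fits inside `f`. -/
lemma IsPLBall.exists_ssubset (hM : IsPLBall k M) {f : Finset α} (hf : f ∈ M)
    (hcard : f.card < k + 1) : ∃ g ∈ M, f ⊂ g := by
  classical
  obtain ⟨S, T, φ, hS, hT, hφ⟩ := hM.exists_faceIso
  rcases f.eq_empty_or_nonempty with rfl | hne
  · obtain ⟨τ, hτ, -⟩ := hT.exists_face_carrier_eq (Set.mem_univ {0}) (by simp)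
    obtain ⟨s, hs, -⟩ := hφ.exists_eq_image hτ
    refine ⟨_, hS.carrier_mem hM.1 hs, Finset.empty_ssubset.2 (Finset.card_pos.1 ?_)⟩
    exact (S.nonempty_of_mem_faces hs).card_pos.trans_le (hS.card_le hs subset_rfl)
  obtain ⟨s, hs, rfl, hsf⟩ := hS.exists_face_carrier_eq hf hne
  obtain ⟨ρ, hρ, hsρ, -⟩ := hT.exists_ssubset_face (hφ.image_mem hs) (Set.mem_univ Finset.univ)
    (Finset.subset_univ _) (by rw [hφ.card_image hs, hsf]; simpa using hcard)
  obtain ⟨r, hr, rfl⟩ := hφ.exists_eq_image hρ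
  have hsr := hφ.subset_of_image_subset hs hr hsρ.subset
  refine ⟨_, hS.carrier_mem hM.1 hr, (carrier_mono hsr).ssubset_of_ne fun h => ?_⟩
  have h1 := hS.card_le hr h.ge
  have h2 := Finset.card_lt_card hsρ
  rw [hφ.card_image hs, hφ.card_image hr] at h2
  omega

/-- A PL ball of positive dimension has a face of codimension one, contained in exactly one
facet. -/
lemma IsPLBall.exists_free_face [DecidableEq α] (hM : IsPLBall k M) (hk : 1 ≤ k) :
    ∃ r ∈ M, r.Nonempty ∧ ∃ v, link M r = {∅, {v}} := by
  classical
  obtain ⟨S, T, φ, hS, hT, hφ⟩ := hM.exists_faceIso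
  have hcard0 : (Finset.univ.erase (0 : Fin (k + 1))).card = k := by simp
  obtain ⟨τ, hτ, hτc, hτk⟩ := hT.exists_face_carrier_eq (Set.mem_univ (Finset.univ.erase 0))
    (Finset.card_pos.1 (by omega))
  rw [hcard0] at hτk
  obtain ⟨ρ, hρ, hτρ, -, hρk⟩ := hT.exists_full_face hτ (Set.mem_univ Finset.univ)
    (Finset.subset_univ _)
  rw [Finset.card_univ, Fintype.card_fin] at hρk
  obtain ⟨s, hs, rfl⟩ := hφ.exists_eq_image hτ
  obtain ⟨r, hr, rfl⟩ := hφ.exists_eq_image hρ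
  have hsr := hφ.subset_of_image_subset hs hr hτρ
  have hsk := hτk
  have hrk := hρk
  rw [hφ.card_image hs] at hsk
  rw [hφ.card_image hr] at hrk
  have huniq : ∀ q ∈ S.faces, s ⊆ q → q.card = k + 1 → q = r := by
    intro q hq hsq hqk
    have heq := hT.eq_of_boundary hτ hτk (by simp [hτc]) (hφ.image_mem hq) hρ
      (Finset.image_subset_image hsq) hτρ (by rw [hφ.card_image hq, hqk]) hρk
    exact (hφ.subset_of_image_subset hq hr heq.le).antisymm
      (hφ.subset_of_image_subset hr hq heq.ge)
  have hgM := hS.carrier_mem hM.1 hr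
  have hcM := hS.carrier_mem hM.1 hs
  have hgk : (carrier r).card = k + 1 :=
    (hM.card_le hgM).antisymm (hrk ▸ hS.card_le hr subset_rfl)
  have hcg := carrier_mono hsr
  -- Otherwise `s` would run through the interior of a facet and lie in two full-dimensional
  -- simplices, against `huniq`.
  have hck : (carrier s).card = k := by
    have h1 := hS.card_le hs subset_rfl
    have h2 := Finset.card_le_card hcg
    by_contra hne
    obtain ⟨q, hq, q', hq', h3, h4, h5, h6, h7⟩ := hS.exists_pair_of_card_succ hM.1 hs (by omega)
    exact h7 ((huniq q hq h3 (by omega)).trans (huniq q' hq' h4 (by omega)).symm)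
  obtain ⟨v, hv⟩ := Finset.card_eq_one.1 (show (carrier r \ carrier s).card = 1 by
    rw [Finset.card_sdiff_of_subset hcg]; omega)
  have hvr : carrier r = {v} ∪ carrier s := by rw [← hv, Finset.sdiff_union_of_subset hcg]
  have hvs : v ∉ carrier s := (Finset.mem_sdiff.1 (hv ▸ Finset.mem_singleton_self v)).2
  refine ⟨carrier s, hcM, Finset.card_pos.1 (by omega), v, Set.ext fun g => ⟨?_, ?_⟩⟩
  · rintro ⟨-, hg, hdisj⟩
    rcases g.eq_empty_or_nonempty with rfl | hgne
    · exact Or.inl rfl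
    right
    have hlt := Finset.card_union_of_disjoint hdisj
    have hgpos := hgne.card_pos
    obtain ⟨q, hq, hsq, hqc, hqk⟩ := hS.exists_full_face hs hg Finset.subset_union_right
    have hle := hM.card_le hg
    have := huniq q hq hsq (by omega)
    subst this
    rw [hqc] at hv
    rw [Set.mem_singleton_iff, ← hv, Finset.union_sdiff_right, hdisj.sdiff_eq_left]
  · rintro (rfl | rfl)
    · exact ⟨hM.1 (Finset.empty_subset _) hcM, by simpa using hcM, by simp⟩
    · exact ⟨hM.1 (by simp [hvr]) hgM, hvr ▸ hgM, by simpa using hvs⟩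

/-- PL balls are connected. -/
lemma IsPLBall.mem_of_connected (hM : IsPLBall k M) {A : Set α} {a b : α} (ha : {a} ∈ M)
    (hb : {b} ∈ M) (haA : a ∈ A)
    (hA : ∀ f ∈ M, ∀ x ∈ f, ∀ y ∈ f, x ∈ A → y ∈ A) : b ∈ A := by
  classical
  obtain ⟨S, T, φ, hS, hT, hφ⟩ := hM.exists_faceIso
  by_contra hbA
  -- Simplices over `A` and over its complement split the simplex `T.space` into two disjoint parts.
  -- Both trace closed sets on a segment, which is connected.
  let P : (Fin (k + 1) →₀ ℝ) → Prop := fun p =>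
    ∃ s ∈ S.faces, ↑(carrier s) ⊆ A ∧ p ∈ convexHull ℝ (s.image φ : Set (Fin (k + 1) →₀ ℝ))
  let Q : (Fin (k + 1) →₀ ℝ) → Prop := fun p =>
    ∃ s ∈ S.faces, ↑(carrier s) ⊆ Aᶜ ∧ p ∈ convexHull ℝ (s.image φ : Set (Fin (k + 1) →₀ ℝ))
  have hP : ∃ p ∈ T.space, P p := by
    obtain ⟨s, hs, hsc, -⟩ := hS.exists_face_carrier_eq ha (by simp)
    obtain ⟨p, hp⟩ := exists_inRelInterior (T.nonempty_of_mem_faces (hφ.image_mem hs))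
    exact ⟨p, SimplicialComplex.mem_space_iff.2 ⟨_, hφ.image_mem hs, hp.mem_convexHull⟩,
      s, hs, by simpa [hsc] using haA, by simpa using hp.mem_convexHull⟩
  have hQ : ∃ p ∈ T.space, Q p := by
    obtain ⟨s, hs, hsc, -⟩ := hS.exists_face_carrier_eq hb (by simp)
    obtain ⟨p, hp⟩ := exists_inRelInterior (T.nonempty_of_mem_faces (hφ.image_mem hs))
    exact ⟨p, SimplicialComplex.mem_space_iff.2 ⟨_, hφ.image_mem hs, hp.mem_convexHull⟩,
      s, hs, by simpa [hsc] using hbA, by simpa using hp.mem_convexHull⟩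
  have hPQ : ∀ p ∈ T.space, P p ∨ Q p := by
    intro p hp
    obtain ⟨t, ht, hpt⟩ := SimplicialComplex.mem_space_iff.1 hp
    obtain ⟨s, hs, rfl⟩ := hφ.exists_eq_image ht
    have hc := hS.carrier_mem hM.1 hs
    by_cases h : ∃ x ∈ carrier s, x ∈ A
    · obtain ⟨x, hx, hxA⟩ := h
      exact Or.inl ⟨s, hs, fun y hy => hA _ hc x hx y hy hxA, hpt⟩
    · push Not at h
      exact Or.inr ⟨s, hs, fun y hy => h y hy, hpt⟩
  have hdisj : ∀ p, P p → Q p → False := by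
    rintro p ⟨s, hs, hsA, hps⟩ ⟨s', hs', hsA', hps'⟩
    have h := T.inter_subset_convexHull (hφ.image_mem hs) (hφ.image_mem hs') ⟨hps, hps'⟩
    obtain ⟨y, hy, hy'⟩ := convexHull_nonempty_iff.1 ⟨p, h⟩
    obtain ⟨x, hx, rfl⟩ := Finset.mem_image.1 (Finset.mem_coe.1 hy)
    obtain ⟨x', hx', hxx⟩ := Finset.mem_image.1 (Finset.mem_coe.1 hy')
    obtain rfl := hφ.1 (mem_vertices_of_mem hs' hx') (mem_vertices_of_mem hs hx) hxx
    have hne : x'.support.Nonempty := by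
      rw [Finsupp.support_nonempty_iff]
      rintro rfl
      simpa using hS.coordSum_eq hs hx
    obtain ⟨v, hv⟩ := hne
    exact hsA' (support_subset_carrier hx' hv) (hsA (support_subset_carrier hx hv))
  obtain ⟨p, hpT, hp⟩ := hP
  obtain ⟨q, hqT, hq⟩ := hQ
  have hconv : Convex ℝ T.space := by
    rw [hT.2.1]
    convert convex_convexHull ℝ ((fun v => Finsupp.single v (1 : ℝ)) ''
      ((Finset.univ : Finset (Fin (k + 1))) : Set (Fin (k + 1)))) using 1
    ext x
    rw [mem_realization_iff isLowerSet_univ, mem_convexHull_single_iff]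
    simp
  have hclosed : ∀ B : Set α, IsClosed {c : ℝ | ∃ s ∈ S.faces, ↑(carrier s) ⊆ B ∧
      p + c • (q - p) ∈ convexHull ℝ (s.image φ : Set (Fin (k + 1) →₀ ℝ))} := by
    intro B
    have heq : {c : ℝ | ∃ s ∈ S.faces, ↑(carrier s) ⊆ B ∧
        p + c • (q - p) ∈ convexHull ℝ (s.image φ : Set (Fin (k + 1) →₀ ℝ))} =
        ⋃ s ∈ {s ∈ S.faces | ↑(carrier s) ⊆ B}, {c : ℝ | p + c • (q - p) ∈
          convexHull ℝ (s.image φ : Set (Fin (k + 1) →₀ ℝ))} := by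
      ext c
      simp [and_assoc]
    rw [heq]
    refine (hS.1.subset (Set.sep_subset _ _)).isClosed_biUnion fun s _ => ?_
    exact isClosed_line_convexHull _ _ _
  have hpre := isPreconnected_closed_iff.1 (isPreconnected_Icc (a := (0 : ℝ)) (b := 1)) _ _
    (hclosed A) (hclosed Aᶜ) (fun c hc => by
      refine hPQ _ ?_
      have := hconv hpT hqT (sub_nonneg.2 hc.2) hc.1 (by ring)
      convert this using 1
      module)
    ⟨0, by simp, by simpa [P] using hp⟩ ⟨1, by simp, by simpa [Q] using hq⟩
  obtain ⟨c, -, hc1, hc2⟩ := hpre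
  exact hdisj _ hc1 hc2

end Ball

/-! ### The one-point ball. -/

/-- The subdivision of a point. -/
noncomputable def pointComplex {E : Type*} [AddCommGroup E] [Module ℝ E] (x : E) :
    SimplicialComplex ℝ E where
  faces := {{x}}
  isRelLowerSet_faces := by
    rintro s rfl
    refine ⟨by simp, fun t ht hne => ?_⟩
    exact (Finset.subset_singleton_iff.1 ht).resolve_left hne.ne_empty
  indep := by
    rintro s rfl
    have : Subsingleton (({x} : Finset E) : Type _) := ⟨fun a b =>
      Subtype.ext ((Finset.mem_singleton.1 a.2).trans (Finset.mem_singleton.1 b.2).symm)⟩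
    exact affineIndependent_of_subsingleton ℝ _
  inter_subset_convexHull := by
    rintro s t rfl rfl
    simp

lemma isSubdivision_pointComplex {α : Type*} {K : Set (Finset α)} (v : α)
    (hv : ∀ f, f ∈ K ↔ f = ∅ ∨ f = {v}) :
    IsSubdivision K (pointComplex (Finsupp.single v (1 : ℝ))) := by
  refine ⟨Set.finite_singleton _, ?_, ?_⟩
  · have h1 : (pointComplex (Finsupp.single v (1 : ℝ))).space = {Finsupp.single v (1 : ℝ)} := by
      simp [SimplicialComplex.space, pointComplex]
    rw [h1]
    ext x
    simp [realization, hv]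
  · rintro s rfl
    exact ⟨{v}, (hv _).2 (Or.inr rfl), by simp⟩

lemma isPLBall_point {α : Type*} (v : α) : IsPLBall 0 ({∅, {v}} : Set (Finset α)) := by
  refine ⟨?_, pointComplex (Finsupp.single v 1), pointComplex (Finsupp.single 0 1),
    isSubdivision_pointComplex v (by simp), isSubdivision_pointComplex 0 ?_,
    fun _ => Finsupp.single 0 1, ?_, ?_⟩
  · rintro f g hg (rfl | rfl)
    · exact Or.inl (Finset.subset_empty.1 hg)
    · exact Finset.subset_singleton_iff.1 hg
  · intro f
    simp only [Set.mem_univ, true_iff]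
    exact Finset.subset_singleton_iff.1 fun x _ =>
      Finset.mem_singleton.2 (Subsingleton.elim (α := Fin 1) x 0)
  · intro x hx y hy _
    simp only [SimplicialComplex.vertices, pointComplex, Set.mem_singleton_iff,
      Set.mem_ofPred_eq, Finset.singleton_inj] at hx hy
    rw [hx, hy]
  · ext t
    simp only [pointComplex, Set.mem_singleton_iff, Set.mem_ofPred_eq, exists_eq_left,
      Finset.coe_singleton, Set.image_singleton, Finset.coe_eq_singleton]

/-! ### Boundary faces, stacked `2`-balls and facets of an extension. -/

section Ball

variable {α : Type*} {k d : ℕ} {M B : Set (Finset α)}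

lemma IsPLBall.exists_card_eq (hM : IsPLBall k M) : ∃ f ∈ M, f.card = k + 1 := by
  classical
  obtain ⟨S, T, φ, hS, hT, hφ⟩ := hM.exists_faceIso
  obtain ⟨τ, hτ, -, hτk⟩ := hT.exists_face_carrier_eq (Set.mem_univ Finset.univ) (by simp)
  obtain ⟨s, hs, rfl⟩ := hφ.exists_eq_image hτ
  rw [hφ.card_image hs, Finset.card_univ, Fintype.card_fin] at hτk
  have hc := hS.carrier_mem hM.1 hs
  exact ⟨_, hc, (hM.card_le hc).antisymm (hτk ▸ hS.card_le hs subset_rfl)⟩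

variable [DecidableEq α]

lemma link_link (hB : IsLowerSet B) {f r : Finset α} (hr : r ∈ link B f) :
    link (link B f) r = link B (f ∪ r) := by
  ext g
  constructor
  · rintro ⟨⟨h1, h2, h3⟩, ⟨h4, h5, h6⟩, h7⟩
    refine ⟨h1, ?_, Finset.disjoint_union_right.2 ⟨h3, h7⟩⟩
    rwa [Finset.union_comm f r, ← Finset.union_assoc]
  · rintro ⟨h1, h2, h3⟩
    obtain ⟨h4, h5⟩ := Finset.disjoint_union_right.1 h3
    have h6 : g ∪ r ∪ f ∈ B := by rwa [Finset.union_assoc, Finset.union_comm r f]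
    exact ⟨⟨h1, hB (Finset.union_subset_union_left Finset.subset_union_left) h6, h4⟩,
      ⟨hB Finset.subset_union_left h6, h6, Finset.disjoint_union_left.2 ⟨h4, hr.2.2⟩⟩, h5⟩

/-- The boundary of a PL `d`-ball is pure of dimension `d - 1`. -/
lemma IsPLBall.card_of_maximal_boundary (hB : IsPLBall d B) {f : Finset α} (hf : f ∈ boundary B)
    (hmax : ∀ g ∈ boundary B, f ⊆ g → g = f) : f.card = d := by
  obtain ⟨hfB, k, hk⟩ := hf
  rcases k.eq_zero_or_pos with rfl | hpos
  -- The link is a `0`-ball, so `f` plus one vertex is a face. If that face were not of full size,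
  -- purity would enlarge it and produce a link face with two vertices.
  · obtain ⟨g, hg, hgc⟩ := hk.exists_card_eq
    have hcard := Finset.card_union_of_disjoint hg.2.2
    have hle := hB.card_le hg.2.1
    by_contra hne
    obtain ⟨h, hh, hlt⟩ := hB.exists_ssubset hg.2.1 (by omega)
    have hfh : f ⊆ h := Finset.subset_union_right.trans hlt.subset
    have hmem : h \ f ∈ link B f :=
      ⟨hB.1 Finset.sdiff_subset hh, by rwa [Finset.sdiff_union_of_subset hfh],
        Finset.sdiff_disjoint⟩
    have h1 := hk.card_le hmem
    rw [Finset.card_sdiff_of_subset hfh] at h1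
    have h2 := Finset.card_lt_card hlt
    omega
  -- A free face `r` of the link makes `f ∪ r` a strictly larger boundary face.
  · obtain ⟨r, hr, ⟨x, hx⟩, v, hv⟩ := hk.exists_free_face hpos
    rw [link_link hB.1 hr] at hv
    have hmem : f ∪ r ∈ boundary B := by
      refine ⟨by simpa [Finset.union_comm] using hr.2.1, 0, ?_⟩
      rw [hv]
      exact isPLBall_point v
    have heq := hmax _ hmem Finset.subset_union_left
    have hxf : x ∈ f := heq ▸ Finset.mem_union_right f hx
    exact absurd hxf (Finset.disjoint_left.1 hr.2.2 hx)

/-- A `0`-stacked PL `2`-ball is a single triangle. -/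
lemma IsPLBall.eq_triangle_of_isStacked (hB : IsPLBall 2 B) (hst : IsStacked 2 0 B) :
    ∃ F ∈ B, F.card = 3 ∧ ∀ f ∈ B, f ⊆ F := by
  have hlink : ∀ f ∈ B, f.card ≤ 2 → ∃ k, IsPLBall k (link B f) := fun f hf hc =>
    (hst f hf (by push_cast; omega)).2
  obtain ⟨F, hF, hFc⟩ := hB.exists_card_eq
  -- Connectedness is used at three levels. The link of an edge has faces of at most one vertex, so
  -- being connected it has a single vertex, here the third vertex of `F`. Next, the link of a
  -- vertex of `F` stays in `F`, and finally so does `B`.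
  have hedge : ∀ a ∈ F, ∀ u ∈ F, a ≠ u → ∀ v, {v, a, u} ∈ B → v ∈ F := by
    intro a ha u hu hau v hv
    by_cases hva : v = a
    · rwa [hva]
    by_cases hvu : v = u
    · rwa [hvu]
    have hc2 := Finset.card_pair hau
    have hsub : ({a, u} : Finset α) ⊆ F := by
      simp [Finset.insert_subset_iff, ha, hu]
    obtain ⟨c, hc⟩ := Finset.card_pos.1 (show 0 < (F \ {a, u}).card by
      rw [Finset.card_sdiff_of_subset hsub]; omega)
    rw [Finset.mem_sdiff] at hc
    obtain ⟨k, hk⟩ := hlink {a, u} (hB.1 hsub hF) hc2.le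
    have hmem : ∀ y, y ∉ ({a, u} : Finset α) → {y, a, u} ∈ B → {y} ∈ link B {a, u} := by
      intro y hy hyB
      exact ⟨hB.1 (by simp) hyB, hyB, by simpa using hy⟩
    have hvc := hk.mem_of_connected (A := {c})
      (hmem c hc.2 (hB.1 (Finset.insert_subset hc.1 hsub) hF))
      (hmem v (by simp [hva, hvu]) hv) rfl (by
        rintro f ⟨-, hf, hdisj⟩ x hx y hy rfl
        have h1 := Finset.card_union_of_disjoint hdisj
        have h2 := hB.card_le hf
        exact Finset.card_le_one.1 (by omega : f.card ≤ 1) y hy x hx)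
    rw [Set.mem_singleton_iff.1 hvc]
    exact hc.1
  have hvert : ∀ a ∈ F, ∀ x, {x, a} ∈ B → x ∈ F := by
    intro a ha x hx
    by_cases hxa : x = a
    · rwa [hxa]
    obtain ⟨b, hb⟩ := Finset.card_pos.1 (show 0 < (F.erase a).card by
      rw [Finset.card_erase_of_mem ha]; omega)
    rw [Finset.mem_erase] at hb
    obtain ⟨k, hk⟩ := hlink {a} (hB.1 (by simpa using ha) hF) (by simp)
    have hmem : ∀ y, y ≠ a → {y, a} ∈ B → {y} ∈ link B {a} := by
      intro y hy hyB
      exact ⟨hB.1 (by simp) hyB, hyB, by simpa using hy⟩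
    refine hk.mem_of_connected (A := (F : Set α)) (hmem b hb.1 (hB.1 ?_ hF)) (hmem x hxa hx) hb.2 ?_
    · simp [Finset.insert_subset_iff, ha, hb.2]
    · rintro f ⟨-, hf, hdisj⟩ u hu v hv huF
      refine hedge a ha u huF ?_ v (hB.1 ?_ hf)
      · rintro rfl
        exact Finset.disjoint_left.1 hdisj hu (by simp)
      · simp [Finset.insert_subset_iff, hu, hv]
  refine ⟨F, hF, hFc, fun f hf x hx => ?_⟩
  obtain ⟨a, ha⟩ := Finset.card_pos.1 (show 0 < F.card by omega)
  refine hB.mem_of_connected (A := (F : Set α)) (hB.1 (by simpa using ha) hF)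
    (hB.1 (by simpa using hx) hf) ha ?_
  intro g hg u hu v hv huF
  exact hvert u huF v (hB.1 (by simp [Finset.insert_subset_iff, hu, hv]) hg)

/-- Faces above one outside `B` are also outside `B`, so maximality passes to `L`. A boundary face
without `w` is never maximal, as `w` can be added. -/
lemma facets_of_extension {L K : Set (Finset α)} {w : α} (hBL : B ⊆ L) (hB : IsLowerSet B)
    (hw : ∀ f ∈ L, w ∉ f) (hK : K = (L \ B) ∪ join (boundary B) {∅, {w}}) {h : Finset α}
    (hh : h ∈ facets K) : h ∈ facets L ∨
      ∃ f ∈ boundary B, (∀ g ∈ boundary B, f ⊆ g → g = f) ∧ h = f ∪ {w} := by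
  subst hK
  obtain ⟨hh, hmax⟩ := hh
  have hmem : ∀ f ∈ boundary B, f ∪ {w} ∈ (L \ B) ∪ join (boundary B) {∅, {w}} := fun f hf =>
    Or.inr ⟨f, hf, {w}, by simp, rfl⟩
  rcases hh with hh | ⟨f, hf, g, hg, rfl⟩
  · refine Or.inl ⟨hh.1, fun g hg hhg => hmax g (Or.inl ⟨hg, fun hgB => hh.2 (hB hhg hgB)⟩) hhg⟩
  · right
    rcases hg with rfl | rfl
    · have := hmax _ (hmem f hf) (by simp)
      exact absurd (by simpa using this) (hw f (hBL hf.1))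
    · refine ⟨f, hf, fun g hg hfg => ?_, rfl⟩
      have heq := hmax _ (hmem g hg) (Finset.union_subset_union_left hfg)
      refine Finset.Subset.antisymm (fun x hx => ?_) hfg
      have hx' : x ∈ f ∪ {w} := heq ▸ Finset.mem_union_left _ hx
      rcases Finset.mem_union.1 hx' with h | h
      · exact h
      · rw [Finset.mem_singleton.1 h] at hx
        exact absurd hx (hw g (hBL hg.1))

end Ball

/-! ### Gale evenness and parity classes of indices. -/

/-- Gale's evenness condition. -/
def IsGale {n : ℕ} (G : Finset (Fin n)) : Prop :=
  ∀ a b : Fin n, a < b → a ∉ G → b ∉ G → Even (G.filter fun i => a < i ∧ i < b).card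

section Gale

variable {n : ℕ} {G f : Finset (Fin n)}

/-- Multiply the values at `a` and `b`: indices strictly between contribute negative factors, all
others positive ones, so their number is even. -/
lemma isGale_of_pos_prod {t : Fin n → ℝ} (ht : StrictMono t) {c : ℝ}
    (h : ∀ j, j ∉ G → 0 < c * ∏ i ∈ G, (t j - t i)) : IsGale G := by
  intro a b hab ha hb
  have h1 := mul_pos (h a ha) (h b hb)
  have h2 : 0 < (c * c) * ∏ i ∈ G, (t a - t i) * (t b - t i) := by
    rw [Finset.prod_mul_distrib]
    linarith
  have h3 : 0 < ∏ i ∈ G, (t a - t i) * (t b - t i) :=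
    pos_of_mul_pos_right h2 (mul_self_nonneg c)
  rw [← Finset.prod_filter_mul_prod_filter_not G fun i => a < i ∧ i < b] at h3
  have h4 : 0 < ∏ i ∈ G with ¬(a < i ∧ i < b), (t a - t i) * (t b - t i) := by
    refine Finset.prod_pos fun i hi => ?_
    obtain ⟨hiG, hi⟩ := Finset.mem_filter.1 hi
    rcases lt_or_gt_of_ne (ne_of_mem_of_not_mem hiG ha) with hia | hia
    · have := ht hia
      have := ht (hia.trans hab)
      exact mul_pos (by linarith) (by linarith)
    · have hbi : b < i := (le_of_not_gt fun h => hi ⟨hia, h⟩).lt_of_ne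
        (ne_of_mem_of_not_mem hiG hb).symm
      have := ht hia
      have := ht hbi
      exact mul_pos_of_neg_of_neg (by linarith) (by linarith)
  have h5 := pos_of_mul_pos_left h3 h4.le
  have h6 : 0 < ∏ i ∈ G with a < i ∧ i < b, -((t a - t i) * (t b - t i)) := by
    refine Finset.prod_pos fun i hi => ?_
    obtain ⟨-, hi1, hi2⟩ := Finset.mem_filter.1 hi
    have := mul_pos (sub_pos.2 (ht hi1)) (sub_pos.2 (ht hi2))
    nlinarith
  by_contra hodd
  rw [Nat.not_even_iff_odd] at hodd
  rw [Finset.prod_neg, hodd.neg_one_pow] at h6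
  linarith

lemma IsGale.exists_neighbor (hG : IsGale G) {x : Fin n} (hx : x ∈ G) (h0 : 0 < x.val)
    (h1 : x.val + 1 < n) : ∃ y ∈ G, y.val = x.val + 1 ∨ y.val + 1 = x.val := by
  by_contra! hcon
  have h := hG ⟨x.val - 1, by omega⟩ ⟨x.val + 1, h1⟩ (by simp only [Fin.lt_def]; omega)
    (fun h => (hcon _ h).2 (by simp; omega)) (fun h => (hcon _ h).1 rfl)
  have heq : (G.filter fun i => (⟨x.val - 1, by omega⟩ : Fin n) < i ∧ i < ⟨x.val + 1, h1⟩) =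
      {x} := by
    ext i
    simp only [Finset.mem_filter, Fin.lt_def, Finset.mem_singleton, Fin.ext_iff]
    refine ⟨by omega, fun hi => ⟨?_, by omega⟩⟩
    rwa [Fin.ext hi]
  rw [heq] at h
  simp at h

lemma IsGale.exists_neighbor_of_three (hG : IsGale G) {x y z : Fin n} (hx : x ∈ G) (hy : y ∈ G)
    (hz : z ∈ G) (h0 : 0 < x.val) (h1 : z.val + 1 < n) (hxy : y.val = x.val + 1)
    (hyz : z.val = y.val + 1) : ∃ u ∈ G, u.val = z.val + 1 ∨ u.val + 1 = x.val := by
  by_contra! hcon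
  have h := hG ⟨x.val - 1, by omega⟩ ⟨z.val + 1, h1⟩ (by simp only [Fin.lt_def]; omega)
    (fun h => (hcon _ h).2 (by simp; omega)) (fun h => (hcon _ h).1 rfl)
  have heq : (G.filter fun i => (⟨x.val - 1, by omega⟩ : Fin n) < i ∧ i < ⟨z.val + 1, h1⟩) =
      {x, y, z} := by
    ext i
    simp only [Finset.mem_filter, Fin.lt_def, Finset.mem_singleton, Finset.mem_insert]
    constructor
    · rintro ⟨-, h2⟩
      simp only [Fin.ext_iff]
      omega
    · rintro (rfl | rfl | rfl)
      · exact ⟨hx, by omega⟩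
      · exact ⟨hy, by omega⟩
      · exact ⟨hz, by omega⟩
  rw [heq, Finset.card_insert_of_notMem, Finset.card_pair] at h
  · exact absurd h (by decide)
  · simp only [Ne, Fin.ext_iff]; omega
  · simp only [Finset.mem_insert, Finset.mem_singleton, Fin.ext_iff]; omega

/-- Adjacent indices have opposite parity, so a neighbor in `G` of an element of `f` is the one
element `p` of `G` outside `f`. Two interior elements of `f` would give a block `x, p, z`, and
evenness would require a further neighbor, again equal to `p`. -/
lemma IsGale.interior_subsingleton (hG : IsGale G) (hfG : f ⊆ G) (hcard : G.card ≤ f.card + 1)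
    (hpar : ∀ x ∈ f, ∀ y ∈ f, x.val % 2 = y.val % 2) :
    (f.filter fun x => 0 < x.val ∧ x.val + 1 < n).card ≤ 1 := by
  have hsub : ∀ y ∈ G, y ∉ f → ∀ z ∈ G, z ∉ f → y = z := by
    intro y hy hyf z hz hzf
    have : (G \ f).card ≤ 1 := by
      rw [Finset.card_sdiff_of_subset hfG]
      omega
    exact Finset.card_le_one.1 this y (Finset.mem_sdiff.2 ⟨hy, hyf⟩) z
      (Finset.mem_sdiff.2 ⟨hz, hzf⟩)
  have key : ∀ x ∈ f, ∀ z ∈ f, x < z → 0 < x.val → z.val + 1 < n → False := by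
    intro x hx z hz hxz h0 h1
    rw [Fin.lt_def] at hxz
    obtain ⟨p, hp, hpx⟩ := hG.exists_neighbor (hfG hx) h0 (by omega)
    obtain ⟨q, hq, hqz⟩ := hG.exists_neighbor (hfG hz) (by omega) h1
    have hpf : p ∉ f := fun h => by
      have := hpar p h x hx
      omega
    have hqf : q ∉ f := fun h => by
      have := hpar q h z hz
      omega
    obtain rfl := hsub p hp hpf q hq hqf
    obtain ⟨u, hu, huv⟩ := hG.exists_neighbor_of_three (hfG hx) hp (hfG hz) h0 h1 (by omega)
      (by omega)
    have huf : u ∉ f := fun h => by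
      have h2 := hpar u h x hx
      have h3 := hpar u h z hz
      omega
    have := congrArg Fin.val (hsub u hu huf p hp hpf)
    omega
  refine Finset.card_le_one.2 fun x hx z hz => ?_
  simp only [Finset.mem_filter] at hx hz
  rcases lt_trichotomy x z with h | h | h
  · exact (key x hx.1 z hz.1 h hx.2.1 hz.2.2).elim
  · exact h
  · exact (key z hz.1 x hx.1 h hz.2.1 hx.2.2).elim

lemma card_endpoints_le (m : ℕ) (P : Finset (Fin n)) (hP : ∀ x ∈ P, x.val = m ∨ x.val + 1 = n) :
    P.card ≤ 2 ∧ ((∀ x ∈ P, x.val ≠ m) → P.card ≤ 1) := by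
  constructor
  · have : P.image Fin.val ⊆ {m, n - 1} := by
      intro y hy
      obtain ⟨x, hx, rfl⟩ := Finset.mem_image.1 hy
      have := hP x hx
      simp only [Finset.mem_insert, Finset.mem_singleton]
      omega
    rw [← Finset.card_image_of_injective P Fin.val_injective]
    exact (Finset.card_le_card this).trans Finset.card_le_two
  · intro h
    refine Finset.card_le_one.2 fun x hx y hy => Fin.ext ?_
    have := hP x hx
    have := hP y hy
    have := h x hx
    have := h y hy
    omega

lemma IsGale.card_le_of_parity (hG : IsGale G) (hfG : f ⊆ G) (hcard : G.card ≤ f.card + 1)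
    (hpar : ∀ x ∈ f, ∀ y ∈ f, x.val % 2 = y.val % 2) :
    f.card ≤ 3 ∧ ((∀ x ∈ f, x.val ≠ 0) → f.card ≤ 2) := by
  have h1 := hG.interior_subsingleton hfG hcard hpar
  have h2 := Finset.card_filter_add_card_filter_not (s := f)
    (fun x : Fin n => 0 < x.val ∧ x.val + 1 < n)
  obtain ⟨h3, h4⟩ := card_endpoints_le 0
    (f.filter fun x : Fin n => ¬(0 < x.val ∧ x.val + 1 < n)) (fun x hx => by
      have := (Finset.mem_filter.1 hx).2
      have := x.2
      omega)
  refine ⟨by omega, fun h => ?_⟩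
  have := h4 fun x hx => h x (Finset.mem_filter.1 hx).1
  omega

lemma IsGale.card_le_two_of_parity (hG : IsGale G)
    (hpar : ∀ x ∈ G, ∀ y ∈ G, x.val % 2 = y.val % 2) : G.card ≤ 2 := by
  refine (card_endpoints_le 0 G fun x hx => ?_).1
  by_contra! h
  have := x.2
  obtain ⟨y, hy, hyx⟩ := hG.exists_neighbor hx (by omega) (by omega)
  have := hpar y hy x hx
  omega

end Gale

/-! ### Facets of cyclic polytopes via polynomials on the moment curve. -/

section Cyclic

variable {D n : ℕ}

/-- The polynomial whose values are those of a linear functional on the moment curve. -/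
noncomputable def functionalPoly (l : (Fin D → ℝ) →ₗ[ℝ] ℝ) : Polynomial ℝ :=
  ∑ i : Fin D, Polynomial.monomial (i.val + 1) (l (Pi.single i 1))

lemma eval_functionalPoly (l : (Fin D → ℝ) →ₗ[ℝ] ℝ) (s : ℝ) :
    (functionalPoly l).eval s = l (momentCurve D s) := by
  rw [LinearMap.pi_apply_eq_sum_univ l]
  simp only [functionalPoly, Polynomial.eval_finsetSum, Polynomial.eval_monomial, momentCurve,
    smul_eq_mul]
  refine Finset.sum_congr rfl fun i _ => ?_
  rw [mul_comm]
  congr 2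
  ext j
  simp [Pi.single_apply, eq_comm]

lemma natDegree_functionalPoly_le (l : (Fin D → ℝ) →ₗ[ℝ] ℝ) :
    (functionalPoly l).natDegree ≤ D :=
  Polynomial.natDegree_sum_le_of_forall_le _ _ fun i _ =>
    (Polynomial.natDegree_monomial_le _).trans i.2

lemma eq_zero_of_functionalPoly_eq_C {l : (Fin D → ℝ) →ₗ[ℝ] ℝ} {a : ℝ}
    (h : functionalPoly l = Polynomial.C a) : l = 0 := by
  refine LinearMap.pi_ext' fun i => LinearMap.ext_ring ?_
  have h1 := congrArg (fun p => Polynomial.coeff p (i.val + 1)) h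
  simp only [functionalPoly, Polynomial.finsetSum_coeff, Polynomial.coeff_monomial,
    Polynomial.coeff_C, Nat.add_right_cancel_iff] at h1
  rw [Finset.sum_eq_single i (fun j _ hj => if_neg fun h => hj (Fin.ext h)) (by simp)] at h1
  simpa using h1

lemma card_le_of_functional_eq {l : (Fin D → ℝ) →ₗ[ℝ] ℝ} (hl : l ≠ 0) {a : ℝ} {t : Fin n → ℝ}
    (ht : StrictMono t) (G : Finset (Fin n)) (hG : ∀ i ∈ G, l (momentCurve D (t i)) = a) :
    G.card ≤ D := by
  set p := Polynomial.C a - functionalPoly l with hp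
  have hp0 : p ≠ 0 := fun h => hl (eq_zero_of_functionalPoly_eq_C (sub_eq_zero.1 h).symm)
  have hdeg : p.natDegree ≤ D := (Polynomial.natDegree_sub_le _ _).trans
    (max_le (by simp) (natDegree_functionalPoly_le l))
  have hsub : (G.image t).val ⊆ p.roots := by
    intro x hx
    obtain ⟨i, hi, rfl⟩ := Finset.mem_image.1 (Finset.mem_def.2 hx)
    rw [Polynomial.mem_roots hp0, Polynomial.IsRoot, hp, Polynomial.eval_sub, Polynomial.eval_C,
      eval_functionalPoly, hG i hi, sub_self]
  have := Polynomial.card_le_degree_of_subset_roots hsub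
  rw [Finset.card_image_of_injective _ ht.injective] at this
  omega

/-- Otherwise a nonzero functional is constant on `n > D` points of the moment curve, giving a
polynomial of degree at most `D` too many roots. -/
lemma finrank_vectorSpan_cyclicPolytope {t : Fin n → ℝ} (ht : StrictMono t) (hn : D < n) :
    Module.finrank ℝ (vectorSpan ℝ (cyclicPolytope D t)) = D := by
  have htop : vectorSpan ℝ (cyclicPolytope D t) = ⊤ := by
    by_contra hne
    obtain ⟨l, hl, hker⟩ := Submodule.exists_le_ker_of_lt_top _ (lt_top_iff_ne_top.2 hne)
    have hmem : ∀ i, momentCurve D (t i) ∈ cyclicPolytope D t := fun i =>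
      subset_convexHull ℝ _ ⟨i, rfl⟩
    have := card_le_of_functional_eq hl (a := l (momentCurve D (t ⟨0, by omega⟩))) ht Finset.univ
      fun i _ => by
        have := hker (vsub_mem_vectorSpan ℝ (hmem i) (hmem ⟨0, by omega⟩))
        rwa [LinearMap.mem_ker, vsub_eq_sub, map_sub, sub_eq_zero] at this
    rw [Finset.card_univ, Fintype.card_fin] at this
    omega
  rw [htop]
  simp

lemma finrank_vectorSpan_convexHull_le {E : Type*} [AddCommGroup E] [Module ℝ E] (g : Finset E)
    (hg : g.Nonempty) : Module.finrank ℝ (vectorSpan ℝ (convexHull ℝ (g : Set E))) + 1 ≤ g.card := by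
  classical
  rw [← direction_affineSpan, affineSpan_convexHull, direction_affineSpan]
  have := finrank_vectorSpan_image_finset_le ℝ (id : E → E) g (n := g.card - 1)
    (by have := hg.card_pos; omega)
  rw [Finset.image_id] at this
  have := hg.card_pos
  omega

lemma momentCurve_injective (hD : 1 ≤ D) : Function.Injective (momentCurve D) := by
  intro x y h
  simpa [momentCurve] using congrFun h ⟨0, hD⟩

/-- Every face of the boundary complex of a cyclic polytope lies in a facet that satisfies Gale's
evenness condition. -/
lemma exists_gale_of_mem_cyclicComplex {t : Fin n → ℝ} (ht : StrictMono t) (hD : 1 ≤ D) (hn : D < n)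
    {s : Finset (Fin n)} (hs : s ∈ cyclicComplex D t) :
    ∃ G ∈ cyclicComplex D t, s ⊆ G ∧ G.card = D ∧ IsGale G := by
  classical
  obtain ⟨g₀, ⟨g, ⟨F, ⟨hFne, hFexp, hFrank⟩, hgF⟩, hg₀⟩, hs⟩ := hs
  obtain ⟨l, hl⟩ := hFexp hFne
  obtain ⟨x₀, hx₀⟩ := hFne
  have hmem : ∀ i, momentCurve D (t i) ∈ cyclicPolytope D t := fun i =>
    subset_convexHull ℝ _ ⟨i, rfl⟩
  have hx₀P : x₀ ∈ cyclicPolytope D t := hFexp.subset hx₀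
  have hle : ∀ y ∈ cyclicPolytope D t, l y ≤ l x₀ := by
    rw [hl] at hx₀
    exact hx₀.2
  have hF : ∀ y ∈ cyclicPolytope D t, y ∈ F ↔ l y = l x₀ := by
    intro y hy
    rw [hl]
    exact ⟨fun h => (hle y hy).antisymm (h.2 x₀ hx₀P),
      fun h => ⟨hy, fun z hz => h ▸ hle z hz⟩⟩
  have hl0 : (l : (Fin D → ℝ) →ₗ[ℝ] ℝ) ≠ 0 := by
    intro h
    have hl' : ∀ y, l y = 0 := fun y => DFunLike.congr_fun h y
    have : F = cyclicPolytope D t :=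
      hFexp.subset.antisymm fun y hy => (hF y hy).2 (by rw [hl', hl'])
    rw [this] at hFrank
    omega
  rw [finrank_vectorSpan_cyclicPolytope ht hn] at hFrank
  have hPc : IsCompact (cyclicPolytope D t) := (Set.finite_range _).isCompact_convexHull ℝ
  have hPconv : Convex ℝ (cyclicPolytope D t) := convex_convexHull ℝ _
  -- Krein–Milman. The dimension of `F` then needs at least `D` extreme points, while the root bound
  -- allows at most `D` curve points on `F`, so `g` is exactly the set of these.
  have hFhull : F = convexHull ℝ (g : Set (Fin D → ℝ)) := by
    rw [← (g.finite_toSet.isClosed_convexHull ℝ).closure_eq, hgF]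
    exact (closure_convexHull_extremePoints (hFexp.isCompact hPc) (hFexp.convex hPconv)).symm
  set G : Finset (Fin n) := Finset.univ.filter fun i => momentCurve D (t i) ∈ F with hGdef
  have hmemG : ∀ i, i ∈ G ↔ l (momentCurve D (t i)) = l x₀ := fun i => by
    rw [hGdef, Finset.mem_filter, hF _ (hmem i)]
    simp
  have hgG : g ⊆ G.image fun i => momentCurve D (t i) := by
    intro y hy
    have hyext : y ∈ F.extremePoints ℝ := hgF ▸ Finset.mem_coe.2 hy
    obtain ⟨i, rfl⟩ := extremePoints_convexHull_subset
      (hFexp.isExtreme.extremePoints_subset_extremePoints hyext)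
    exact Finset.mem_image.2 ⟨i, Finset.mem_filter.2 ⟨Finset.mem_univ _, hyext.1⟩, rfl⟩
  have hinj : Function.Injective fun i => momentCurve D (t i) :=
    (momentCurve_injective hD).comp ht.injective
  have hGle : G.card ≤ D := card_le_of_functional_eq hl0 ht G fun i hi => (hmemG i).1 hi
  have hgne : g.Nonempty := by
    rw [← Finset.coe_nonempty, ← convexHull_nonempty_iff (𝕜 := ℝ), ← hFhull]
    exact ⟨x₀, hx₀⟩
  have hgcard : D ≤ g.card := by
    have := finrank_vectorSpan_convexHull_le g hgne
    rw [← hFhull] at this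
    omega
  have hgG' : g = G.image fun i => momentCurve D (t i) :=
    Finset.eq_of_subset_of_card_le hgG (Finset.card_image_le.trans (hGle.trans hgcard))
  have hGcard : G.card = D := by
    refine hGle.antisymm (hgcard.trans ?_)
    rw [hgG']
    exact Finset.card_image_le
  refine ⟨G, ⟨g, ⟨g, ⟨F, ⟨⟨x₀, hx₀⟩, hFexp, ?_⟩, hgF⟩, subset_rfl⟩, ?_⟩, fun i hi => ?_, hGcard, ?_⟩
  · rw [finrank_vectorSpan_cyclicPolytope ht hn, hFrank]
  · rw [hgG', Finset.coe_image]
  · have h1 : momentCurve D (t i) ∈ g := hg₀ (by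
      rw [← Finset.mem_coe, hs]
      exact ⟨i, hi, rfl⟩)
    have h2 : momentCurve D (t i) ∈ F.extremePoints ℝ := hgF ▸ Finset.mem_coe.2 h1
    exact Finset.mem_filter.2 ⟨Finset.mem_univ _, h2.1⟩
  · set p := Polynomial.C (l x₀) - functionalPoly (l : (Fin D → ℝ) →ₗ[ℝ] ℝ) with hp
    have hpe : ∀ j, p.eval (t j) = l x₀ - l (momentCurve D (t j)) := fun j => by
      rw [hp, Polynomial.eval_sub, Polynomial.eval_C, eval_functionalPoly]
      rfl
    have hdeg : p.natDegree ≤ D := (Polynomial.natDegree_sub_le _ _).trans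
      (max_le (by simp) (natDegree_functionalPoly_le _))
    have hp0 : p ≠ 0 := fun h => hl0 (eq_zero_of_functionalPoly_eq_C (sub_eq_zero.1 h).symm)
    -- The defining polynomial has the `D` parameters of `G` as roots and degree at most `D`, so it
    -- is a constant times their product; it is positive at the other parameters.
    obtain ⟨q, hq⟩ : (∏ i ∈ G, (Polynomial.X - Polynomial.C (t i))) ∣ p := by
      refine Finset.prod_dvd_of_coprime
        ((Polynomial.pairwise_coprime_X_sub_C ht.injective).set_pairwise _) fun i hi => ?_
      rw [Polynomial.dvd_iff_isRoot, Polynomial.IsRoot, hpe, (hmemG i).1 hi, sub_self]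
    have hmonic : (∏ i ∈ G, (Polynomial.X - Polynomial.C (t i))).Monic :=
      Polynomial.monic_prod_of_monic _ _ fun i _ => Polynomial.monic_X_sub_C _
    have hq0 : q ≠ 0 := by
      rintro rfl
      exact hp0 (by rw [hq, mul_zero])
    have hqdeg : q.natDegree = 0 := by
      rw [hq, hmonic.natDegree_mul' hq0, Polynomial.natDegree_prod_of_monic _ _ fun i _ =>
        Polynomial.monic_X_sub_C _] at hdeg
      simp only [Polynomial.natDegree_X_sub_C, Finset.sum_const, smul_eq_mul, mul_one] at hdeg
      omega
    refine isGale_of_pos_prod ht (c := q.coeff 0) fun j hj => ?_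
    have h1 : p.eval (t j) = q.coeff 0 * ∏ i ∈ G, (t j - t i) := by
      rw [hq, Polynomial.eval_mul, Polynomial.eq_C_of_natDegree_eq_zero hqdeg, Polynomial.eval_C,
        Polynomial.eval_prod, mul_comm]
      simp
    rw [← h1, hpe]
    exact sub_pos.2 ((hle _ (hmem j)).lt_of_ne fun h => hj ((hmemG j).2 h))

end Cyclic

/-! ### The coloring. -/

lemma isColorable_two_of_predicate {α : Type*} {H : Set (Finset α)} (P : α → Prop)
    (h : ∀ f ∈ H, ∃ x ∈ f, ∃ y ∈ f, P x ∧ ¬ P y) : IsColorable 2 H := by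
  classical
  refine ⟨fun x => if P x then 0 else 1, fun i f hf hsub => ?_⟩
  obtain ⟨x, hx, y, hy, hPx, hPy⟩ := h f hf
  have h1 := hsub (Finset.mem_coe.2 hx)
  have h2 := hsub (Finset.mem_coe.2 hy)
  simp only [Set.mem_preimage, Set.mem_singleton_iff, if_pos hPx] at h1
  simp only [Set.mem_preimage, Set.mem_singleton_iff, if_neg hPy] at h2
  exact absurd (h1.trans h2.symm) (by decide)

lemma exists_even_odd {n : ℕ} {G : Finset (Fin n)} (hG : IsGale G) (hcard : 3 ≤ G.card) :
    ∃ x ∈ G, ∃ y ∈ G, x.val % 2 = 0 ∧ y.val % 2 ≠ 0 := by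
  by_contra! h
  have := hG.card_le_two_of_parity fun x hx y hy => by
    have h1 := h x hx y hy
    have h2 := h y hy x hx
    omega
  omega

/-- There is a parity `m` for the new vertex such that no facet of the boundary of the ball has all
its vertices of parity `m`. -/
lemma exists_parity {α : Type*} [DecidableEq α] {d n : ℕ} (hd : 2 ≤ d) (hn : d + 2 ≤ n)
    {t : Fin n → ℝ} (ht : StrictMono t) {e : Fin n ↪ α} {B : Set (Finset α)}
    (hBL : B ⊆ relabel e (cyclicComplex (d + 1) t)) (hB : IsPLBall d B)
    (hst : IsStacked d ((d + 1) / 2 - 1) B) :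
    ∃ m, m < 2 ∧ ∀ s : Finset (Fin n), s.map e ∈ boundary B → s.card = d →
      ¬ ∀ x ∈ s, x.val % 2 = m := by
  rcases hd.eq_or_lt with rfl | hd
  -- Here `(2 + 1) / 2 - 1` reduces to `0`. A parity occurring at most once in the triangle cannot
  -- fill one of its edges.
  · obtain ⟨F', hF', hFc, hF⟩ := hB.eq_triangle_of_isStacked hst
    obtain ⟨F, hFL, rfl⟩ := hBL hF'
    rw [Finset.card_map] at hFc
    have hsplit := Finset.card_filter_add_card_filter_not (s := F) fun x : Fin n => x.val % 2 = 0
    have hsub : ∀ (s : Finset (Fin n)), s.map e ∈ boundary B → s ⊆ F := fun s hs =>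
      Finset.map_subset_map.1 (hF _ hs.1)
    by_cases h : (F.filter fun x => x.val % 2 = 0).card ≤ 1
    · refine ⟨0, by omega, fun s hs hsc hpar => ?_⟩
      have : s ⊆ F.filter fun x => x.val % 2 = 0 := fun x hx =>
        Finset.mem_filter.2 ⟨hsub s hs hx, hpar x hx⟩
      have := Finset.card_le_card this
      omega
    · refine ⟨1, by omega, fun s hs hsc hpar => ?_⟩
      have : s ⊆ F.filter fun x => ¬ x.val % 2 = 0 := fun x hx =>
        Finset.mem_filter.2 ⟨hsub s hs hx, by have := hpar x hx; omega⟩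
      have := Finset.card_le_card this
      omega
  · refine ⟨1, by omega, fun s hs hsc hpar => ?_⟩
    obtain ⟨s', hs', heq⟩ := hBL hs.1
    obtain rfl := Finset.map_injective e heq
    obtain ⟨G, -, hsG, hGc, hG⟩ := exists_gale_of_mem_cyclicComplex ht (by omega) (by omega) hs'
    have := (hG.card_le_of_parity hsG (by omega) fun x hx y hy => by
      rw [hpar x hx, hpar y hy]).2 fun x hx h0 => by
        have := hpar x hx
        omega
    omega

end NeighborlySphere

theorem mainTheorem8 {α : Type*} [DecidableEq α] (d n : ℕ) (hd : 2 ≤ d) (hn : d + 2 ≤ n)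
    (t : Fin n → ℝ) (ht : StrictMono t) (e : Fin n ↪ α) (w : α) (K : Set (Finset α))
    (hK : NeighborlySphere.IsSingleElementExtension d (Finset.univ.map e)
      (NeighborlySphere.relabel e (NeighborlySphere.cyclicComplex (d + 1) t)) w K) :
    NeighborlySphere.IsColorable 2 (NeighborlySphere.facets K) := by
  open NeighborlySphere in
  obtain ⟨hw, B, hBL, hB, -, hst, hK⟩ := hK
  have hwe : ∀ i, e i ≠ w := fun i h => hw (by simp [← h])
  obtain ⟨m, hm2, hm⟩ := exists_parity hd hn ht hBL hB hst
  -- The predicate means "even", with `w` given parity `m`.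
  refine isColorable_two_of_predicate
    (fun x => (x = w ∧ m = 0) ∨ ∃ i, e i = x ∧ i.val % 2 = 0) fun h hh => ?_
  have hPw : ((w = w ∧ m = 0) ∨ ∃ i, e i = w ∧ i.val % 2 = 0) ↔ m = 0 := by
    simp [hwe]
  have hPe : ∀ i, ((e i = w ∧ m = 0) ∨ ∃ j, e j = e i ∧ j.val % 2 = 0) ↔ i.val % 2 = 0 := by
    intro i
    simp [hwe]
  have hwL : ∀ f ∈ relabel e (cyclicComplex (d + 1) t), w ∉ f := by
    rintro _ ⟨s, -, rfl⟩ hws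
    obtain ⟨i, -, hi⟩ := Finset.mem_map.1 hws
    exact hwe i hi
  rcases facets_of_extension hBL hB.1 hwL hK hh with ⟨⟨s, hs, rfl⟩, hmax⟩ | ⟨f, hf, hmax, rfl⟩
  · obtain ⟨G, hGL, hsG, hGc, hG⟩ :=
      exists_gale_of_mem_cyclicComplex ht (by omega) (by omega) hs
    -- By maximality the facet is itself the Gale facet containing it.
    obtain rfl := Finset.map_injective e
      (hmax (G.map e) ⟨G, hGL, rfl⟩ (Finset.map_subset_map.2 hsG))
    obtain ⟨x, hx, y, hy, hx0, hy0⟩ := exists_even_odd hG (by omega)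
    exact ⟨e x, Finset.mem_map_of_mem e hx, e y, Finset.mem_map_of_mem e hy,
      (hPe x).2 hx0, fun h => hy0 ((hPe y).1 h)⟩
  · have hfc := hB.card_of_maximal_boundary hf hmax
    obtain ⟨s, -, rfl⟩ := hBL hf.1
    rw [Finset.card_map] at hfc
    have hs := hm s hf hfc
    push Not at hs
    obtain ⟨x, hx, hxm⟩ := hs
    have hxmem : e x ∈ s.map e ∪ {w} := Finset.mem_union_left _ (Finset.mem_map_of_mem e hx)
    have hwmem : w ∈ s.map e ∪ {w} := Finset.mem_union_right _ (Finset.mem_singleton_self w)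
    by_cases hm0 : m = 0
    · exact ⟨w, hwmem, e x, hxmem, hPw.2 hm0, fun h => hxm (((hPe x).1 h).trans hm0.symm)⟩
    · exact ⟨e x, hxmem, w, hwmem, (hPe x).2 (by omega), fun h => hm0 (hPw.1 h)⟩
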